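/- Let $n \ge 1$ and let $(W_n, S_n)$ be the Coxeter system of type $B_n$, with $S_n = \{t, s_1, \dots, s_{n-1}\}$, where $ts_1$ has order $4$, $s_is_{i+1}$ has order $3$, and all other pairs of distinct generators commute. Let $\ell$ be the length function, let $\ell_t(w)$ be the number of occurrences of $t$ in a reduced expression of $w$, and put $\ell_s = \ell - \ell_t$. Let $\Gamma = \mathbb{Z}^2$ with the lexicographic order, let $A = \mathbb{Z}[\Gamma]$ with $\mathbb{Z}$-basis $(v^\gamma)_{\gamma\in\Gamma}$, put $V = v^{(1,0)}$, let $A_{<0} = \bigoplus_{\gamma<0}\mathbb{Z}v^\gamma$, and let $L(w) = (\ell_t(w), \ell_s(w)) \in \Gamma$. Let $\mathcal{H}_n$ be the Hecke algebra of $(W_n,S_n,L)$: the associative $A$-algebra with $A$-basis $(T_w)_{w \in W_n}$ such that $T_wT_{w'} = T_{ww'}$ if $\ell(ww')=\ell(w)+\ell(w')$, and $T_s^2 = 1 + (v^{L(s)} - v^{-L(s)})T_s$ for $s \in S_n$. Let $h = \sum_w a_wT_w \mapsto \overline{h} = \sum_w \overline{a_w}\, T_{w^{-1}}^{-1}$ be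 its semilinear involution, where $\overline{v^\gamma} = v^{-\gamma}$; for $w \in W_n$ let $C_w$ be the unique element of $\mathcal{H}_n$ with $\overline{C_w} = C_w$ and $C_w \in T_w + \bigoplus_{y} A_{<0}T_y$ (the Kazhdan–Lusztig basis); and let $\tau : \mathcal{H}_n \to A$ be the $A$-linear map with $\tau(T_w) = \delta_{1,w}$. Let $r_1 = t_1 = t$ and, for $1 \le i \le n-1$, let $r_{i+1} = s_ir_i$ and $t_{i+1} = s_it_is_i$. For $0 \le l \le n$ let $a_l = r_1r_2\cdots r_l$, let $\mathfrak{S}_l$ be the subgroup of $W_n$ generated by $s_1, \dots, s_{l-1}$, let $\sigma_l$ be the longest element of $\mathfrak{S}_l$, and let $$P_l = (T_{t_1}+V^{-1})(T_{t_2}+V^{-1})\cdots(T_{t_l}+V^{-1}).$$ Then, for all $0 \le l \le n$, $$C_{a_l} = P_l\,T_{\sigma_l}^{-1} = T_{\sigma_l}^{-1}\,P_l ,$$ and, for every $\sigma \in \mathfrak{S}_n$, $$C_{a_l}C_\sigma = C_{a_l\sigma} \qquad\text{and}\qquad \tau(C_{a_l\sigma}) = V^{-l}\,\tau\bigl(T_{\sigma_l}^{-1}C_\sigma\bigr).$$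 -/

import Mathlib

namespace CoxeterKL

section Exchange

variable {B W : Type*} [Group W] {M : CoxeterMatrix B} (cs : CoxeterSystem M W)

open Classical in
/-- The involution `(r, e) ↦ (s r s, e + [r = s])`, used to show that the set of inversions read off a
reduced word depends only on the product of the word. -/
noncomputable def invPerm (i : B) : Equiv.Perm (W × ZMod 2) :=
  Function.Involutive.toPerm
    (fun p => (cs.simple i * p.1 * cs.simple i, p.2 + if p.1 = cs.simple i then 1 else 0))
    (by
      rintro ⟨r, e⟩
      have h : (cs.simple i * r * cs.simple i = cs.simple i) ↔ r = cs.simple i := by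
        constructor
        · intro h
          have h2 : cs.simple i * r = 1 := mul_eq_right.mp h
          rw [← cs.inv_simple i]
          exact eq_inv_of_mul_eq_one_right h2
        · rintro rfl; simp
      have h2 : (1 : ZMod 2) + 1 = 0 := by decide
      ext
      · simp [mul_assoc]
      · simp only [h]
        split_ifs
        · rw [add_assoc, h2, add_zero]
        · simp)

open Classical in
theorem invPerm_word (ω : List B) (p : W × ZMod 2) :
    (ω.map (invPerm cs)).prod p =
      (cs.wordProd ω * p.1 * (cs.wordProd ω)⁻¹,
        p.2 + (((cs.rightInvSeq ω).count p.1 : ℕ) : ZMod 2)) := by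
  induction ω with
  | nil => simp
  | cons i ω ih =>
    rw [List.map_cons, List.prod_cons, Equiv.Perm.mul_apply, ih]
    have h : (cs.wordProd ω * p.1 * (cs.wordProd ω)⁻¹ = cs.simple i) ↔
        (cs.wordProd ω)⁻¹ * cs.simple i * cs.wordProd ω = p.1 := by
      constructor
      · intro h; rw [← h]; group
      · intro h; rw [← h]; group
    ext
    · simp [invPerm, Function.Involutive.toPerm, cs.wordProd_cons, mul_assoc]
    · simp only [invPerm, Function.Involutive.toPerm, Equiv.coe_fn_mk, CoxeterSystem.rightInvSeq,
        List.count_cons, h, beq_iff_eq]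
      split_ifs <;> simp [add_assoc]

open Classical in
theorem count_leftInvSeq_braid (i j : B) (r : W) :
    (((cs.leftInvSeq (CoxeterSystem.alternatingWord i j (2 * M i j))).count r : ℕ) : ZMod 2)
      = 0 := by
  have h1 : cs.leftInvSeq (CoxeterSystem.alternatingWord i j (2 * M i j)) =
      (List.range (2 * M i j)).map
        (fun k => cs.wordProd (CoxeterSystem.alternatingWord j i (2 * k + 1))) := by
    apply List.ext_getElem
    · simp
    · intro k hk1 hk2
      rw [cs.getElem_leftInvSeq_alternatingWord i j (M i j) k (by simpa using hk1)]
      simp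
  have h2 : ∀ k, cs.wordProd (CoxeterSystem.alternatingWord j i (2 * (M i j + k) + 1)) =
      cs.wordProd (CoxeterSystem.alternatingWord j i (2 * k + 1)) := by
    intro k
    rw [cs.prod_alternatingWord_eq_mul_pow, cs.prod_alternatingWord_eq_mul_pow]
    have e1 : (2 * (M i j + k) + 1) / 2 = M i j + k := by omega
    have e2 : (2 * k + 1) / 2 = k := by omega
    rw [e1, e2, pow_add, M.symmetric i j, cs.simple_mul_simple_pow]
    simp
  rw [h1, two_mul, List.range_add, List.map_append, List.count_append, List.map_map]
  have h3 : ((fun k => cs.wordProd (CoxeterSystem.alternatingWord j i (2 * k + 1))) ∘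
      fun x => M i j + x) = fun k => cs.wordProd (CoxeterSystem.alternatingWord j i (2 * k + 1)) := by
    funext k; exact h2 k
  rw [h3]
  push_cast
  exact CharTwo.add_self_eq_zero _

theorem invPerm_mul_self (i : B) : invPerm cs i * invPerm cs i = 1 := by
  ext1 p
  exact (invPerm cs i).left_inv p

theorem invPerm_reverse (ω : List B) :
    (ω.map (invPerm cs)).prod * (ω.reverse.map (invPerm cs)).prod = 1 := by
  induction ω with
  | nil => simp
  | cons i ω ih =>
    rw [List.reverse_cons, List.map_append, List.prod_append, List.map_cons, List.prod_cons,
      mul_assoc, ← mul_assoc _ _ (List.map _ [i]).prod, ih]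
    simp [invPerm_mul_self]

theorem invPerm_alternating (i j : B) (m : ℕ) :
    ((CoxeterSystem.alternatingWord i j (2 * m)).map (invPerm cs)).prod =
      (invPerm cs i * invPerm cs j) ^ m := by
  induction m with
  | zero => simp [CoxeterSystem.alternatingWord]
  | succ m ih =>
    rw [Nat.mul_succ, CoxeterSystem.alternatingWord_succ, CoxeterSystem.alternatingWord_succ]
    simp only [List.concat_eq_append, List.map_append, List.prod_append, ih, pow_succ]
    simp [mul_assoc]

theorem invPerm_isLiftable : M.IsLiftable (invPerm cs) := by
  classical
  intro i j
  rw [← invPerm_alternating]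
  have h := invPerm_reverse cs (CoxeterSystem.alternatingWord i j (2 * M i j))
  suffices h1 : ((CoxeterSystem.alternatingWord i j (2 * M i j)).reverse.map (invPerm cs)).prod = 1 by
    rwa [h1, mul_one] at h
  have hp : cs.wordProd (CoxeterSystem.alternatingWord i j (2 * M i j)) = 1 := by
    rw [cs.prod_alternatingWord_eq_mul_pow]
    simp
  ext1 p
  rw [invPerm_word, cs.wordProd_reverse, hp, cs.rightInvSeq_reverse, List.count_reverse,
    count_leftInvSeq_braid]
  simp

open Classical in
theorem count_rightInvSeq_congr {ω ω' : List B} (h : cs.wordProd ω = cs.wordProd ω') (r : W) :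
    (((cs.rightInvSeq ω).count r : ℕ) : ZMod 2) = (((cs.rightInvSeq ω').count r : ℕ) : ZMod 2) := by
  have key : ∀ ω : List B, (cs.lift ⟨_, invPerm_isLiftable cs⟩) (cs.wordProd ω) =
      (ω.map (invPerm cs)).prod := by
    intro ω
    rw [CoxeterSystem.wordProd, map_list_prod, List.map_map]
    congr 2
    funext i
    simp
  have h1 : (ω.map (invPerm cs)).prod = (ω'.map (invPerm cs)).prod := by
    rw [← key, ← key, h]
  have h2 := congrArg (fun f : Equiv.Perm (W × ZMod 2) => (f (r, 0)).2) h1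
  simpa [invPerm_word] using h2

theorem rightInvSeq_perm {ω ω' : List B} (hω : cs.IsReduced ω) (hω' : cs.IsReduced ω')
    (h : cs.wordProd ω = cs.wordProd ω') :
    (cs.rightInvSeq ω).Perm (cs.rightInvSeq ω') := by
  classical
  rw [List.perm_iff_count]
  intro r
  have h1 := List.nodup_iff_count_le_one.mp hω.nodup_rightInvSeq r
  have h2 := List.nodup_iff_count_le_one.mp hω'.nodup_rightInvSeq r
  have h3 := count_rightInvSeq_congr cs h r
  rw [ZMod.natCast_eq_natCast_iff'] at h3
  omega

/-- If `s w` and `w t` are longer than `w` but `s w t` is not longer than these, then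
`s w = w t`. -/
theorem simple_mul_eq_mul_simple {w : W} {i j : B}
    (h1 : cs.length (cs.simple i * w) = cs.length w + 1)
    (h2 : cs.length (w * cs.simple j) = cs.length w + 1)
    (h3 : cs.length (cs.simple i * w * cs.simple j) = cs.length w) :
    cs.simple i * w = w * cs.simple j := by
  obtain ⟨ω, hω, rfl⟩ := cs.exists_isReduced w
  obtain ⟨ψ, hψ, hψw⟩ := cs.exists_isReduced (cs.simple i * cs.wordProd ω * cs.simple j)
  have e1 : cs.wordProd (ψ.concat j) = cs.wordProd (i :: ω) := by
    rw [cs.wordProd_concat, ← hψw, cs.wordProd_cons]; simp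
  have r1 : cs.IsReduced (ψ.concat j) := by
    have := hψ.eq
    rw [← hψw, h3] at this
    rw [CoxeterSystem.IsReduced, e1, cs.wordProd_cons, h1, List.length_concat, this]
  have r2 : cs.IsReduced (i :: ω) := by
    rw [CoxeterSystem.IsReduced, cs.wordProd_cons, h1, hω.eq]; simp
  have r3 : cs.IsReduced (ω.concat j) := by
    rw [CoxeterSystem.IsReduced, cs.wordProd_concat, h2, hω.eq]; simp
  have m1 : cs.simple j ∈ cs.rightInvSeq (i :: ω) := by
    rw [← (rightInvSeq_perm cs r1 r2 e1).mem_iff, cs.rightInvSeq_concat]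
    simp
  rw [CoxeterSystem.rightInvSeq, List.mem_cons] at m1
  rcases m1 with m1 | m1
  · rw [m1]; group
  · exfalso
    have n3 := r3.nodup_rightInvSeq
    rw [cs.rightInvSeq_concat, List.concat_eq_append, List.nodup_append] at n3
    refine n3.2.2 (cs.simple j) ?_ (cs.simple j) (by simp) rfl
    rw [List.mem_map]
    exact ⟨cs.simple j, m1, by simp⟩

end Exchange

section GroupRing

/-- The group ring `A = ℤ[Γ]`. -/
def GroupRing (Γ : Type*) : Type _ := AddMonoidAlgebra ℤ Γ

/-- The coefficient `a_γ` of `a` on `v ^ γ`. -/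
def GroupRing.coeffAt {Γ : Type*} (a : GroupRing Γ) (γ : Γ) : ℤ := AddMonoidAlgebra.coeff a γ

theorem groupRing_ext {Γ : Type*} {a b : GroupRing Γ} (h : ∀ γ, a.coeffAt γ = b.coeffAt γ) :
    a = b :=
  AddMonoidAlgebra.coeff_injective (Finsupp.ext h)

variable {Γ : Type*} [AddCommGroup Γ]

noncomputable instance : CommRing (GroupRing Γ) :=
  inferInstanceAs (CommRing (AddMonoidAlgebra ℤ Γ))

/-- The basis element `v ^ γ` of `A`. -/
noncomputable def vpow (γ : Γ) : GroupRing Γ := AddMonoidAlgebra.single γ 1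

/-- The involution `v ^ γ ↦ v ^ (-γ)` of `A`. -/
noncomputable def barA : GroupRing Γ ≃+* GroupRing Γ :=
  AddMonoidAlgebra.mapDomainRingEquiv ℤ (AddEquiv.neg Γ)

theorem coeffAt_barA (a : GroupRing Γ) (γ : Γ) : (barA a).coeffAt γ = a.coeffAt (-γ) := by
  have h := AddMonoidAlgebra.coeff_mapDomainRingEquiv (R := ℤ) (AddEquiv.neg Γ) a
  exact DFunLike.congr_fun h γ

theorem coeffAt_sub (a b : GroupRing Γ) (γ : Γ) :
    (a - b).coeffAt γ = a.coeffAt γ - b.coeffAt γ := rfl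

theorem coeffAt_add (a b : GroupRing Γ) (γ : Γ) :
    (a + b).coeffAt γ = a.coeffAt γ + b.coeffAt γ := rfl

theorem coeffAt_neg (a : GroupRing Γ) (γ : Γ) : (-a).coeffAt γ = -a.coeffAt γ := rfl

theorem coeffAt_zero (γ : Γ) : (0 : GroupRing Γ).coeffAt γ = 0 := rfl

theorem barA_barA (a : GroupRing Γ) : barA (barA a) = a :=
  groupRing_ext fun γ => by rw [coeffAt_barA, coeffAt_barA, neg_neg]

theorem barA_vpow (γ : Γ) : barA (vpow γ) = vpow (-γ) :=
  AddMonoidAlgebra.mapDomainRingEquiv_single (R := ℤ) (AddEquiv.neg Γ) 1 γ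

end GroupRing

section Hecke

variable {B W : Type*} [Group W] {M : CoxeterMatrix B} {cs : CoxeterSystem M W}
variable {Γ : Type*} [AddCommGroup Γ] [LinearOrder Γ]

/-- A weight function `L : W → Γ`: `L(ww') = L(w) + L(w')` whenever `ℓ(ww') = ℓ(w) + ℓ(w')`, and
`L(s) > 0` for every simple reflection `s`. -/
structure WeightFunction (cs : CoxeterSystem M W) (Γ : Type*) [AddCommGroup Γ] [LinearOrder Γ] where
  toFun : W → Γ
  map_mul' : ∀ w w' : W, cs.length (w * w') = cs.length w + cs.length w' →
    toFun (w * w') = toFun w + toFun w'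
  pos' : ∀ i : B, 0 < toFun (cs.simple i)

/-- `a ∈ A_{< 0}`. -/
def IsNegative (a : GroupRing Γ) : Prop := ∀ γ : Γ, a.coeffAt γ ≠ 0 → γ < 0

/-- `v ^ L(s) - v ^ (-L(s))`. -/
noncomputable def xi (L : WeightFunction cs Γ) (i : B) : GroupRing Γ :=
  vpow (L.toFun (cs.simple i)) - vpow (-L.toFun (cs.simple i))

/-- The free `A`-module with basis `(e_w)` indexed by `W`. -/
def FreeMod (W Γ : Type*) [AddCommGroup Γ] : Type _ := W →₀ GroupRing Γ

noncomputable instance : AddCommGroup (FreeMod W Γ) :=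
  inferInstanceAs (AddCommGroup (W →₀ GroupRing Γ))

noncomputable instance : Module (GroupRing Γ) (FreeMod W Γ) :=
  inferInstanceAs (Module (GroupRing Γ) (W →₀ GroupRing Γ))

/-- The basis `(e_w)`. -/
noncomputable def stdBasis (W Γ : Type*) [AddCommGroup Γ] :
    Module.Basis W (GroupRing Γ) (FreeMod W Γ) :=
  .ofRepr (LinearEquiv.refl (GroupRing Γ) (W →₀ GroupRing Γ))

/-- The operator on the free module that becomes left multiplication by `T_s`: `e_w ↦ e_{sw}` if
`ℓ(sw) > ℓ(w)`, and `e_w ↦ e_{sw} + (v ^ L(s) - v ^ (-L(s))) e_w` otherwise. -/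
noncomputable def leftOp (L : WeightFunction cs Γ) (i : B) :
    Module.End (GroupRing Γ) (FreeMod W Γ) :=
  (stdBasis W Γ).constr (GroupRing Γ) fun w =>
    if cs.length w < cs.length (cs.simple i * w) then stdBasis W Γ (cs.simple i * w)
    else stdBasis W Γ (cs.simple i * w) + xi L i • stdBasis W Γ w

/-- The analogous operator on the right; it commutes with all `leftOp`. -/
noncomputable def rightOp (L : WeightFunction cs Γ) (i : B) :
    Module.End (GroupRing Γ) (FreeMod W Γ) :=
  (stdBasis W Γ).constr (GroupRing Γ) fun w =>
    if cs.length w < cs.length (w * cs.simple i) then stdBasis W Γ (w * cs.simple i)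
    else stdBasis W Γ (w * cs.simple i) + xi L i • stdBasis W Γ w

/-- The algebra of endomorphisms of the free module generated by the operators `leftOp`. -/
noncomputable def heckeSubalgebra (L : WeightFunction cs Γ) :
    Subalgebra (GroupRing Γ) (Module.End (GroupRing Γ) (FreeMod W Γ)) :=
  Algebra.adjoin (GroupRing Γ) (Set.range (leftOp L))

/-- The Hecke algebra `H(W, S, L)` over `A = ℤ[Γ]`, realised as the algebra of endomorphisms of the
free module with basis `(e_w)` generated by the left multiplication operators. It has the `A`-basis
`T L` with the defining relations `T_mul` and `T_simple_sq` proved below. -/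
def Hecke (L : WeightFunction cs Γ) : Type _ := heckeSubalgebra L

noncomputable instance (L : WeightFunction cs Γ) : Ring (Hecke L) :=
  inferInstanceAs (Ring (heckeSubalgebra L))

noncomputable instance (L : WeightFunction cs Γ) : Algebra (GroupRing Γ) (Hecke L) :=
  inferInstanceAs (Algebra (GroupRing Γ) (heckeSubalgebra L))

theorem leftOp_up (L : WeightFunction cs Γ) {i : B} {w : W}
    (h : cs.length (cs.simple i * w) = cs.length w + 1) :
    leftOp L i (stdBasis W Γ w) = stdBasis W Γ (cs.simple i * w) := by
  rw [leftOp, Module.Basis.constr_basis, if_pos (by omega)]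

theorem leftOp_down (L : WeightFunction cs Γ) {i : B} {w : W}
    (h : cs.length (cs.simple i * w) + 1 = cs.length w) :
    leftOp L i (stdBasis W Γ w) =
      stdBasis W Γ (cs.simple i * w) + xi L i • stdBasis W Γ w := by
  rw [leftOp, Module.Basis.constr_basis, if_neg (by omega)]

theorem rightOp_up (L : WeightFunction cs Γ) {i : B} {w : W}
    (h : cs.length (w * cs.simple i) = cs.length w + 1) :
    rightOp L i (stdBasis W Γ w) = stdBasis W Γ (w * cs.simple i) := by
  rw [rightOp, Module.Basis.constr_basis, if_pos (by omega)]

theorem rightOp_down (L : WeightFunction cs Γ) {i : B} {w : W}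
    (h : cs.length (w * cs.simple i) + 1 = cs.length w) :
    rightOp L i (stdBasis W Γ w) =
      stdBasis W Γ (w * cs.simple i) + xi L i • stdBasis W Γ w := by
  rw [rightOp, Module.Basis.constr_basis, if_neg (by omega)]

theorem xi_eq (L : WeightFunction cs Γ) {w : W} {i j : B}
    (h1 : cs.length (cs.simple i * w) = cs.length w + 1)
    (h : cs.simple i * w = w * cs.simple j) : xi L i = xi L j := by
  have e1 := L.map_mul' (cs.simple i) w (by rw [h1, cs.length_simple, add_comm])
  have e2 := L.map_mul' w (cs.simple j) (by rw [← h, h1, cs.length_simple])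
  rw [h, e2, add_comm] at e1
  rw [xi, xi, add_right_cancel e1]

theorem leftOp_rightOp (L : WeightFunction cs Γ) (i j : B) :
    rightOp L j * leftOp L i = leftOp L i * rightOp L j := by
  refine (stdBasis W Γ).ext fun w => ?_
  simp only [Module.End.mul_apply]
  have ass : cs.simple i * (w * cs.simple j) = cs.simple i * w * cs.simple j :=
    (mul_assoc _ _ _).symm
  have a1 : cs.simple i * (cs.simple i * w) = w := by simp
  have a2 : w * cs.simple j * cs.simple j = w := by simp
  have a3 : cs.simple i * (cs.simple i * w * cs.simple j) = w * cs.simple j := by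
    simp [← mul_assoc]
  have a4 : cs.simple i * w * cs.simple j * cs.simple j = cs.simple i * w := by simp
  have b1 := cs.length_simple_mul w i
  have b2 := cs.length_mul_simple w j
  have b3 := cs.length_mul_simple (cs.simple i * w) j
  have b4 := cs.length_simple_mul (w * cs.simple j) i
  rw [ass] at b4
  rcases b1 with b1 | b1 <;> rcases b2 with b2 | b2
  · rw [leftOp_up L b1, rightOp_up L b2]
    rcases b3 with b3 | b3
    · rw [rightOp_up L b3, leftOp_up L (by rw [ass]; omega), ass]
    · have e := simple_mul_eq_mul_simple cs b1 b2 (by omega)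
      rw [rightOp_down L b3, leftOp_down L (by rw [ass]; omega), ass, xi_eq L b1 e, e]
  · have b3' : cs.length (cs.simple i * w * cs.simple j) + 1 = cs.length (cs.simple i * w) := by
      omega
    rw [leftOp_up L b1, rightOp_down L b2, rightOp_down L b3', map_add, map_smul, leftOp_up L b1,
      leftOp_up L (by rw [ass]; omega), ass]
  · have b3' : cs.length (cs.simple i * w * cs.simple j) = cs.length (cs.simple i * w) + 1 := by
      omega
    rw [leftOp_down L b1, rightOp_up L b2, map_add, map_smul, rightOp_up L b3', rightOp_up L b2,
      leftOp_down L (by rw [ass]; omega), ass]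
  · rw [leftOp_down L b1, rightOp_down L b2, map_add, map_smul, map_add, map_smul,
      leftOp_down L b1, rightOp_down L b2]
    rcases b3 with b3 | b3
    · have e := simple_mul_eq_mul_simple cs (w := cs.simple i * w) (i := i) (j := j)
        (by rw [a1]; omega) b3 (by rw [a1]; omega)
      rw [a1] at e
      have e' : w * cs.simple j = cs.simple i * w := by rw [← cs.simple_mul_simple_cancel_right
        (w := cs.simple i * w) j, ← e]
      have hx := xi_eq L (w := cs.simple i * w) (i := i) (j := j) (by rw [a1]; omega)
        (by rw [a1]; exact e)
      rw [rightOp_up L b3, leftOp_up L (by rw [ass]; omega), ass, hx, e']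
    · rw [rightOp_down L b3, leftOp_down L (by rw [ass]; omega), ass]
      simp only [smul_add, smul_smul, mul_comm (xi L i) (xi L j)]
      abel

theorem hecke_rightOp (L : WeightFunction cs Γ) (h : Hecke L) (j : B)
    (x : FreeMod W Γ) : h.1 (rightOp L j x) = rightOp L j (h.1 x) := by
  have : heckeSubalgebra L ≤
      Subalgebra.centralizer (GroupRing Γ) {rightOp L j} := by
    refine Algebra.adjoin_le ?_
    rintro _ ⟨i, rfl⟩
    rw [SetLike.mem_coe, Subalgebra.mem_centralizer_iff]
    rintro _ rfl
    exact leftOp_rightOp L i j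
  have h2 := (Subalgebra.mem_centralizer_iff _).mp (this h.2) _ rfl
  exact (congrArg (fun f : Module.End (GroupRing Γ) (FreeMod W Γ) => f x) h2).symm

/-- Evaluation of an operator of the Hecke algebra at the basis vector `e_1`. -/
noncomputable def evalOne (L : WeightFunction cs Γ) :
    Hecke L →ₗ[GroupRing Γ] (FreeMod W Γ) :=
  (LinearMap.applyₗ (R := GroupRing Γ) (stdBasis W Γ 1)).comp
    (heckeSubalgebra L).val.toLinearMap

theorem evalOne_apply (L : WeightFunction cs Γ) (h : Hecke L) :
    evalOne L h = h.1 (stdBasis W Γ 1) := rfl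

theorem evalOne_mul (L : WeightFunction cs Γ) (h h' : Hecke L) :
    evalOne L (h * h') = h.1 (evalOne L h') := rfl

theorem evalOne_injective (L : WeightFunction cs Γ) : Function.Injective (evalOne L) := by
  rw [injective_iff_map_eq_zero]
  intro h h0
  have key : ∀ (k : ℕ) (w : W), cs.length w = k → h.1 (stdBasis W Γ w) = 0 := by
    intro k
    induction k with
    | zero =>
      intro w hw
      rw [cs.length_eq_zero_iff] at hw
      rw [hw]; exact h0
    | succ k ih =>
      intro w hw
      obtain ⟨j, hj⟩ := cs.exists_rightDescent_of_ne_one (w := w) (by rintro rfl; simp at hw)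
      rw [cs.isRightDescent_iff] at hj
      have := rightOp_up L (i := j) (w := w * cs.simple j) (by simp; omega)
      rw [cs.simple_mul_simple_cancel_right] at this
      rw [← this, hecke_rightOp, ih _ (by omega), map_zero]
  apply Subtype.ext
  refine (stdBasis W Γ).ext fun w => ?_
  exact key _ w rfl

/-- The operator `leftOp` as an element of the Hecke algebra. -/
noncomputable def gen (L : WeightFunction cs Γ) (i : B) : Hecke L :=
  ⟨leftOp L i, Algebra.subset_adjoin ⟨i, rfl⟩⟩

theorem evalOne_word (L : WeightFunction cs Γ) (ω : List B) (hω : cs.IsReduced ω) :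
    evalOne L (ω.map (gen L)).prod = stdBasis W Γ (cs.wordProd ω) := by
  induction ω with
  | nil => rfl
  | cons i ω ih =>
    have h1 : cs.IsReduced ω := by simpa using hω.drop 1
    rw [List.map_cons, List.prod_cons, evalOne_mul, ih h1, cs.wordProd_cons]
    refine leftOp_up L ?_
    have := hω.eq
    rw [cs.wordProd_cons] at this
    rw [this, h1.eq, List.length_cons]

theorem evalOne_surjective (L : WeightFunction cs Γ) : Function.Surjective (evalOne L) := by
  rw [← LinearMap.range_eq_top, eq_top_iff, ← (stdBasis W Γ).span_eq, Submodule.span_le]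
  rintro _ ⟨w, rfl⟩
  obtain ⟨ω, hω, rfl⟩ := cs.exists_isReduced w
  exact ⟨_, evalOne_word L ω hω⟩

/-- The standard `A`-basis `(T_w)` of the Hecke algebra: `T_w` is the element with `T_w e_1 = e_w`. -/
noncomputable def T (L : WeightFunction cs Γ) : Module.Basis W (GroupRing Γ) (Hecke L) :=
  (stdBasis W Γ).map
    (LinearEquiv.ofBijective (evalOne L) ⟨evalOne_injective L, evalOne_surjective L⟩).symm

theorem evalOne_T (L : WeightFunction cs Γ) (w : W) : evalOne L (T L w) = stdBasis W Γ w := by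
  rw [T, Module.Basis.map_apply]
  exact LinearEquiv.apply_symm_apply
    (LinearEquiv.ofBijective (evalOne L) ⟨evalOne_injective L, evalOne_surjective L⟩) _

theorem T_wordProd (L : WeightFunction cs Γ) (ω : List B) (hω : cs.IsReduced ω) :
    T L (cs.wordProd ω) = (ω.map (gen L)).prod :=
  evalOne_injective L (by rw [evalOne_T, evalOne_word L ω hω])

/-- First defining relation: `T_w T_{w'} = T_{ww'}` if `ℓ(ww') = ℓ(w) + ℓ(w')`. -/
theorem T_mul (L : WeightFunction cs Γ) (w w' : W)
    (h : cs.length (w * w') = cs.length w + cs.length w') :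
    T L w * T L w' = T L (w * w') := by
  obtain ⟨ω, hω, rfl⟩ := cs.exists_isReduced w
  obtain ⟨ω', hω', rfl⟩ := cs.exists_isReduced w'
  have : cs.IsReduced (ω ++ ω') := by
    rw [CoxeterSystem.IsReduced, cs.wordProd_append, h, hω.eq, hω'.eq, List.length_append]
  rw [← cs.wordProd_append, T_wordProd L _ hω, T_wordProd L _ hω', T_wordProd L _ this,
    List.map_append, List.prod_append]

theorem T_one (L : WeightFunction cs Γ) : T L 1 = 1 := by
  simpa using T_wordProd L [] (by simp [CoxeterSystem.IsReduced])

/-- Second defining relation: `T_s ^ 2 = 1 + (v ^ L(s) - v ^ (-L(s))) T_s`. -/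
theorem T_simple_sq (L : WeightFunction cs Γ) (i : B) :
    T L (cs.simple i) * T L (cs.simple i) = 1 + xi L i • T L (cs.simple i) := by
  have h1 : T L (cs.simple i) = gen L i := by
    simpa using T_wordProd L [i] (by simp [CoxeterSystem.IsReduced])
  apply evalOne_injective L
  rw [map_add, map_smul, evalOne_mul, evalOne_T, ← T_one, evalOne_T, h1]
  have := leftOp_down L (i := i) (w := cs.simple i) (by simp)
  rw [cs.simple_mul_simple_self] at this
  exact this

theorem T_simple_inv (L : WeightFunction cs Γ) (i : B) :
    T L (cs.simple i) * (T L (cs.simple i) - algebraMap (GroupRing Γ) (Hecke L) (xi L i)) = 1 ∧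
    (T L (cs.simple i) - algebraMap (GroupRing Γ) (Hecke L) (xi L i)) * T L (cs.simple i) = 1 := by
  constructor
  · rw [mul_sub, T_simple_sq, Algebra.smul_def, Algebra.commutes, add_sub_cancel_right]
  · rw [sub_mul, T_simple_sq, Algebra.smul_def, add_sub_cancel_right]

theorem isUnit_T (L : WeightFunction cs Γ) (w : W) : IsUnit (T L w) := by
  obtain ⟨ω, hω, rfl⟩ := cs.exists_isReduced w
  induction ω with
  | nil => simp [T_one]
  | cons i ω ih =>
    have h1 : cs.IsReduced ω := by simpa using hω.drop 1
    have := hω.eq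
    rw [cs.wordProd_cons] at this ⊢
    rw [← T_mul L _ _ (by rw [this, h1.eq, cs.length_simple, List.length_cons, add_comm])]
    exact IsUnit.mul ⟨⟨_, _, (T_simple_inv L i).1, (T_simple_inv L i).2⟩, rfl⟩ (ih h1)

/-- `T_w` as a unit of the Hecke algebra. -/
noncomputable def TUnit (L : WeightFunction cs Γ) (w : W) : (Hecke L)ˣ := (isUnit_T L w).unit

/-- The semilinear involution `∑ a_w T_w ↦ ∑ (barA a_w) T_{w⁻¹}⁻¹` of the Hecke algebra. -/
noncomputable def bar (L : WeightFunction cs Γ) (h : Hecke L) : Hecke L :=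
  ((T L).repr h).sum fun w a => barA a • (((TUnit L w⁻¹)⁻¹ : (Hecke L)ˣ) : Hecke L)

section KL

theorem hecke_induction (L : WeightFunction cs Γ) {P : Hecke L → Prop}
    (hadd : ∀ h h', P h → P h' → P (h + h')) (hT : ∀ (a : GroupRing Γ) (w : W), P (a • T L w)) (h : Hecke L) : P h := by
  rw [← (T L).linearCombination_repr h]
  induction (T L).repr h using Finsupp.induction_linear with
  | zero => simpa using hT 0 1
  | add f g hf hg => rw [map_add]; exact hadd _ _ hf hg
  | single w a => rw [Finsupp.linearCombination_single]; exact hT a w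

theorem bar_add (L : WeightFunction cs Γ) (h h' : Hecke L) :
    bar L (h + h') = bar L h + bar L h' := by
  classical
  rw [bar, map_add, Finsupp.sum_add_index']
  · rfl
  · simp
  · simp [add_smul]

theorem bar_smul (L : WeightFunction cs Γ) (a : GroupRing Γ) (h : Hecke L) :
    bar L (a • h) = barA a • bar L h := by
  rw [bar, map_smul, Finsupp.sum_smul_index' (by simp), bar, Finsupp.smul_sum]
  simp [mul_smul]

theorem bar_T (L : WeightFunction cs Γ) (w : W) :
    bar L (T L w) = (((TUnit L w⁻¹)⁻¹ : (Hecke L)ˣ) : Hecke L) := by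
  rw [bar, Module.Basis.repr_self, Finsupp.sum_single_index (by simp), map_one, one_smul]

theorem bar_zero (L : WeightFunction cs Γ) : bar L 0 = 0 := by simp [bar]

theorem bar_sub (L : WeightFunction cs Γ) (h h' : Hecke L) :
    bar L (h - h') = bar L h - bar L h' := by
  rw [eq_sub_iff_add_eq, ← bar_add, sub_add_cancel]

theorem bar_neg (L : WeightFunction cs Γ) (h : Hecke L) : bar L (-h) = -bar L h := by
  rw [← zero_sub, bar_sub, bar_zero, zero_sub]

theorem barA_xi (L : WeightFunction cs Γ) (i : B) : barA (xi L i) = -xi L i := by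
  rw [xi, map_sub, barA_vpow, barA_vpow, neg_neg, neg_sub]

/-- The inverse of `T_s`. -/
noncomputable def Tsinv (L : WeightFunction cs Γ) (i : B) : Hecke L :=
  T L (cs.simple i) - algebraMap (GroupRing Γ) (Hecke L) (xi L i)

theorem bar_T_mul (L : WeightFunction cs Γ) {i : B} {w : W}
    (h : cs.length (cs.simple i * w) = cs.length w + 1) :
    bar L (T L (cs.simple i * w)) = Tsinv L i * bar L (T L w) := by
  rw [bar_T, bar_T, Units.inv_eq_of_mul_eq_one_right]
  have h1 : ((TUnit L (cs.simple i * w)⁻¹ : (Hecke L)ˣ) : Hecke L) =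
      ((TUnit L w⁻¹ : (Hecke L)ˣ) : Hecke L) * T L (cs.simple i) := by
    change T L _ = T L _ * T L _
    rw [T_mul, mul_inv_rev, cs.inv_simple]
    rw [cs.length_simple, ← cs.length_inv, mul_inv_rev, inv_inv, cs.inv_simple, h, cs.length_inv]
  rw [h1, mul_assoc, ← mul_assoc (T L _), Tsinv, (T_simple_inv L i).1, one_mul, Units.mul_inv]

theorem T_simple_mul_up (L : WeightFunction cs Γ) {i : B} {w : W}
    (h : cs.length (cs.simple i * w) = cs.length w + 1) :
    T L (cs.simple i) * T L w = T L (cs.simple i * w) :=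
  T_mul L _ _ (by rw [h, cs.length_simple, add_comm])

theorem T_simple_mul_down (L : WeightFunction cs Γ) {i : B} {w : W}
    (h : cs.length (cs.simple i * w) + 1 = cs.length w) :
    T L (cs.simple i) * T L w = T L (cs.simple i * w) + xi L i • T L w := by
  have e := T_simple_mul_up L (i := i) (w := cs.simple i * w) (by simpa using h.symm)
  rw [cs.simple_mul_simple_cancel_left] at e
  rw [← e, ← mul_assoc, T_simple_sq, add_mul, one_mul, smul_mul_assoc]

theorem bar_T_simple_mul (L : WeightFunction cs Γ) (i : B) (h : Hecke L) :
    bar L (T L (cs.simple i) * h) = Tsinv L i * bar L h := by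
  induction h using hecke_induction L with
  | hadd h h' e e' => rw [mul_add, bar_add, e, e', bar_add, mul_add]
  | hT a w =>
    rw [mul_smul_comm, bar_smul, bar_smul, mul_smul_comm]
    congr 1
    rcases cs.length_simple_mul w i with h | h
    · rw [T_simple_mul_up L h, bar_T_mul L h]
    · have e := bar_T_mul L (i := i) (w := cs.simple i * w) (by simpa using h.symm)
      rw [cs.simple_mul_simple_cancel_left] at e
      have e2 : T L (cs.simple i) * bar L (T L w) = bar L (T L (cs.simple i * w)) := by
        rw [e, ← mul_assoc, Tsinv, (T_simple_inv L i).1, one_mul]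
      rw [T_simple_mul_down L h, bar_add, bar_smul, barA_xi, Tsinv, sub_mul, e2, neg_smul,
        ← Algebra.smul_def, sub_eq_add_neg]

theorem bar_Tsinv_mul (L : WeightFunction cs Γ) (i : B) (h : Hecke L) :
    bar L (Tsinv L i * h) = T L (cs.simple i) * bar L h := by
  rw [Tsinv, sub_mul, bar_sub, bar_T_simple_mul, ← Algebra.smul_def, bar_smul, barA_xi, Tsinv,
    sub_mul, ← Algebra.smul_def, neg_smul, sub_neg_eq_add, sub_add_cancel]

theorem exists_simple_mul (cs : CoxeterSystem M W) {w : W} (hw : w ≠ 1) :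
    ∃ i u, w = cs.simple i * u ∧ cs.length (cs.simple i * u) = cs.length u + 1 := by
  obtain ⟨i, hi⟩ := cs.exists_leftDescent_of_ne_one hw
  rw [cs.isLeftDescent_iff] at hi
  exact ⟨i, cs.simple i * w, by simp, by simpa using hi.symm⟩

theorem length_induction (cs : CoxeterSystem M W) {P : W → Prop} (h1 : P 1)
    (hs : ∀ i u, cs.length (cs.simple i * u) = cs.length u + 1 → P u → P (cs.simple i * u))
    (w : W) : P w := by
  induction hk : cs.length w generalizing w with
  | zero => rw [cs.length_eq_zero_iff] at hk; rwa [hk]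
  | succ k ih =>
    obtain ⟨i, u, rfl, hu⟩ := exists_simple_mul cs (w := w) (by rintro rfl; simp at hk)
    exact hs i u hu (ih u (by omega))

theorem bar_T_one (L : WeightFunction cs Γ) : bar L (T L 1) = 1 := by
  rw [bar_T, inv_one, Units.inv_eq_of_mul_eq_one_right]
  rw [mul_one]; exact T_one L

theorem bar_bar (L : WeightFunction cs Γ) (h : Hecke L) : bar L (bar L h) = h := by
  induction h using hecke_induction L with
  | hadd h h' e e' => rw [bar_add, bar_add, e, e']
  | hT a w =>
    rw [bar_smul, bar_smul, barA_barA]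
    congr 1
    induction w using length_induction cs with
    | h1 => rw [bar_T_one, ← T_one, bar_T_one, T_one]
    | hs i u hu ih => rw [bar_T_mul L hu, bar_Tsinv_mul, ih, T_simple_mul_up L hu]

/-- The span of the `T_y` with `ℓ(y) < k`. -/
noncomputable def Fil (L : WeightFunction cs Γ) (k : ℕ) : Submodule (GroupRing Γ) (Hecke L) :=
  Submodule.span (GroupRing Γ) (T L '' {y | cs.length y < k})

theorem mem_Fil (L : WeightFunction cs Γ) (k : ℕ) (h : Hecke L) :
    h ∈ Fil L k ↔ ∀ y, (T L).repr h y ≠ 0 → cs.length y < k := by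
  rw [Fil, Module.Basis.mem_span_image]
  simp [Set.subset_def]

theorem T_mem_Fil (L : WeightFunction cs Γ) {k : ℕ} {w : W} (h : cs.length w < k) :
    T L w ∈ Fil L k := Submodule.subset_span ⟨w, h, rfl⟩

theorem Fil_mono (L : WeightFunction cs Γ) {k k' : ℕ} (h : k ≤ k') : Fil L k ≤ Fil L k' :=
  Submodule.span_mono (Set.image_mono fun _ hy => lt_of_lt_of_le hy h)

theorem T_simple_mul_mem (L : WeightFunction cs Γ) (i : B) {k : ℕ} {h : Hecke L}
    (hh : h ∈ Fil L k) : T L (cs.simple i) * h ∈ Fil L (k + 1) := by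
  induction hh using Submodule.span_induction with
  | mem x hx =>
    obtain ⟨y, hy, rfl⟩ := hx
    change cs.length y < k at hy
    rcases cs.length_simple_mul y i with e | e
    · rw [T_simple_mul_up L e]
      exact T_mem_Fil L (by omega)
    · rw [T_simple_mul_down L e]
      exact add_mem (T_mem_Fil L (by omega)) (Submodule.smul_mem _ _ (T_mem_Fil L (by omega)))
  | zero => simp
  | add x y _ _ hx hy => rw [mul_add]; exact add_mem hx hy
  | smul a x _ hx => rw [mul_smul_comm]; exact Submodule.smul_mem _ _ hx

theorem bar_T_sub_mem (L : WeightFunction cs Γ) (w : W) :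
    bar L (T L w) - T L w ∈ Fil L (cs.length w) := by
  induction w using length_induction cs with
  | h1 => rw [bar_T_one, T_one, sub_self]; exact zero_mem _
  | hs i u hu ih =>
    have e : bar L (T L (cs.simple i * u)) - T L (cs.simple i * u) =
        T L (cs.simple i) * (bar L (T L u) - T L u) - xi L i • (bar L (T L u) - T L u)
          - xi L i • T L u := by
      rw [bar_T_mul L hu, ← T_simple_mul_up L hu, Tsinv, sub_mul, ← Algebra.smul_def, mul_sub,
        smul_sub]
      abel
    rw [e, hu]
    exact sub_mem (sub_mem (T_simple_mul_mem L i ih)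
      (Submodule.smul_mem _ _ (Fil_mono L (Nat.le_succ _) ih)))
      (Submodule.smul_mem _ _ (T_mem_Fil L (Nat.lt_succ_self _)))

theorem repr_bar (L : WeightFunction cs Γ) {k : ℕ} {h : Hecke L} (hh : h ∈ Fil L (k + 1))
    (y : W) (hy : cs.length y = k) : (T L).repr (bar L h) y = barA ((T L).repr h y) := by
  induction hh using Submodule.span_induction with
  | mem x hx =>
    obtain ⟨z, hz, rfl⟩ := hx
    change cs.length z < k + 1 at hz
    have e := bar_T_sub_mem L z
    rw [mem_Fil] at e
    have e2 : (T L).repr (bar L (T L z) - T L z) y = 0 := by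
      by_contra h0
      have := e y h0
      omega
    rw [map_sub, Finsupp.sub_apply, sub_eq_zero] at e2
    rw [e2, Module.Basis.repr_self]
    classical
    rw [Finsupp.single_apply]
    split_ifs <;> simp
  | zero => simp [bar_zero]
  | add x z _ _ hx hz => simp [bar_add, hx, hz]
  | smul a x _ hx => simp [bar_smul, hx]

theorem bar_mem_Fil (L : WeightFunction cs Γ) {k : ℕ} {h : Hecke L} (hh : h ∈ Fil L k) :
    bar L h ∈ Fil L k := by
  induction hh using Submodule.span_induction with
  | mem x hx =>
    obtain ⟨z, hz, rfl⟩ := hx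
    rw [← sub_add_cancel (bar L (T L z)) (T L z)]
    exact add_mem (Fil_mono L (le_of_lt hz) (bar_T_sub_mem L z)) (T_mem_Fil L hz)
  | zero => simp [bar_zero]
  | add x y _ _ hx hy => rw [bar_add]; exact add_mem hx hy
  | smul a x _ hx => rw [bar_smul]; exact Submodule.smul_mem _ _ hx

theorem mem_Fil_of_top (L : WeightFunction cs Γ) {k : ℕ} {h : Hecke L} (hh : h ∈ Fil L (k + 1))
    (h0 : ∀ y, cs.length y = k → (T L).repr h y = 0) : h ∈ Fil L k := by
  rw [mem_Fil] at hh ⊢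
  intro y hy
  have h1 := hh y hy
  have h2 : cs.length y ≠ k := fun h => hy (h0 y h)
  omega

theorem exists_mem_Fil (L : WeightFunction cs Γ) (h : Hecke L) : ∃ k, h ∈ Fil L k := by
  refine ⟨((T L).repr h).support.sup cs.length + 1, ?_⟩
  rw [mem_Fil]
  intro y hy
  exact Nat.lt_succ_of_le (Finset.le_sup (f := cs.length) (Finsupp.mem_support_iff.mpr hy))

theorem eq_zero_of_mem_Fil_zero (L : WeightFunction cs Γ) {h : Hecke L} (hh : h ∈ Fil L 0) :
    h = 0 := by
  rw [mem_Fil] at hh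
  apply (T L).ext_elem
  intro y
  by_contra h0
  exact absurd (hh y (by simpa using h0)) (by omega)

theorem eq_zero_of_isNegative [IsOrderedAddMonoid Γ] {c : GroupRing Γ} (h1 : IsNegative c)
    (h2 : barA c = c) : c = 0 := by
  refine groupRing_ext fun γ => ?_
  rw [coeffAt_zero]
  by_contra h0
  have h3 := h1 γ h0
  rw [← h2, coeffAt_barA] at h0
  have h4 := h1 _ h0
  exact lt_asymm h3 (neg_neg_iff_pos.mp h4)

theorem exists_negative_part [IsOrderedAddMonoid Γ] {c : GroupRing Γ} (hc : barA c = -c) :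
    ∃ q : GroupRing Γ, IsNegative q ∧ q - barA q = c ∧ (c = 0 → q = 0) := by
  classical
  let q : GroupRing Γ := AddMonoidAlgebra.ofCoeff
    ((AddMonoidAlgebra.coeff (R := ℤ) c).filter (· < (0 : Γ)))
  have hq : ∀ γ, q.coeffAt γ = if γ < 0 then c.coeffAt γ else 0 := fun γ =>
    Finsupp.filter_apply _ _ _
  refine ⟨q, ?_, ?_, ?_⟩
  · intro γ h
    by_contra h0
    exact h (by rw [hq, if_neg h0])
  · refine groupRing_ext fun γ => ?_
    have h1 : c.coeffAt (-γ) = -c.coeffAt γ := by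
      rw [← coeffAt_barA, hc, coeffAt_neg]
    rw [coeffAt_sub, coeffAt_barA, hq, hq, h1]
    simp only [neg_neg_iff_pos]
    rcases lt_trichotomy γ 0 with h | h | h
    · rw [if_pos h, if_neg (not_lt_of_gt h), sub_zero]
    · subst h
      rw [neg_zero] at h1
      simp; omega
    · rw [if_neg (not_lt_of_gt h), if_pos h, zero_sub, neg_neg]
  · rintro rfl
    refine groupRing_ext fun γ => ?_
    rw [hq, coeffAt_zero]; simp

/-- The two conditions characterising the Kazhdan-Lusztig element `C_w`: it is fixed by the
involution, and it lies in `T_w + ⊕_y A_{< 0} T_y`. -/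
def IsKL (L : WeightFunction cs Γ) (w : W) (C : Hecke L) : Prop :=
  bar L C = C ∧ ∀ y : W, IsNegative ((T L).repr (C - T L w) y)

theorem eq_zero_of_bar_eq [IsOrderedAddMonoid Γ] (L : WeightFunction cs Γ) {h : Hecke L}
    (h1 : bar L h = h) (h2 : ∀ y, IsNegative ((T L).repr h y)) : h = 0 := by
  obtain ⟨k, hk⟩ := exists_mem_Fil L h
  induction k with
  | zero => exact eq_zero_of_mem_Fil_zero L hk
  | succ k ih =>
    refine ih (mem_Fil_of_top L hk fun y hy => eq_zero_of_isNegative (h2 y) ?_)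
    rw [← repr_bar L hk y hy, h1]

theorem isNegative_add {a b : GroupRing Γ} (ha : IsNegative a) (hb : IsNegative b) :
    IsNegative (a + b) := by
  intro γ h
  by_contra h0
  have h1 : a.coeffAt γ = 0 := by by_contra h; exact h0 (ha γ h)
  have h2 : b.coeffAt γ = 0 := by by_contra h; exact h0 (hb γ h)
  exact h (by rw [coeffAt_add, h1, h2, add_zero])

theorem isNegative_sub {a b : GroupRing Γ} (ha : IsNegative a) (hb : IsNegative b) :
    IsNegative (a - b) := by
  rw [sub_eq_add_neg]
  refine isNegative_add ha fun γ h => hb γ ?_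
  rwa [coeffAt_neg, neg_ne_zero] at h

theorem exists_sub_bar [IsOrderedAddMonoid Γ] (L : WeightFunction cs Γ) (k : ℕ) :
    ∀ h : Hecke L, h ∈ Fil L k → bar L h = -h →
      ∃ g : Hecke L, (∀ y, IsNegative ((T L).repr g y)) ∧ g - bar L g = h := by
  classical
  induction k with
  | zero =>
    intro h hh _
    rw [eq_zero_of_mem_Fil_zero L hh]
    exact ⟨0, fun y γ h => absurd (by simp [coeffAt_zero]) h, by simp [bar_zero]⟩
  | succ k ih =>
    intro h hh hb
    have hc : ∀ y, cs.length y = k → barA ((T L).repr h y) = -(T L).repr h y := by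
      intro y hy
      rw [← repr_bar L hh y hy, hb]; simp
    have hq : ∀ y, ∃ q : GroupRing Γ, IsNegative q ∧
        (cs.length y = k → q - barA q = (T L).repr h y) ∧
        (q ≠ 0 → cs.length y = k ∧ (T L).repr h y ≠ 0) := by
      intro y
      by_cases hy : cs.length y = k
      · obtain ⟨q, h1, h2, h3⟩ := exists_negative_part (hc y hy)
        exact ⟨q, h1, fun _ => h2, fun h => ⟨hy, fun h' => h (h3 h')⟩⟩
      · exact ⟨0, fun γ h => absurd (coeffAt_zero γ) h, fun h => absurd h hy,
          fun h => absurd rfl h⟩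
    choose q q1 q2 q3 using hq
    let f : W →₀ GroupRing Γ := Finsupp.onFinset ((T L).repr h).support q
      fun y hy => Finsupp.mem_support_iff.mpr (q3 y hy).2
    let g₀ : Hecke L := (T L).repr.symm f
    have hg₀ : ∀ y, (T L).repr g₀ y = q y := by
      intro y
      simp [g₀, f]
    have mg : g₀ ∈ Fil L (k + 1) := by
      rw [mem_Fil]
      intro y hy
      rw [hg₀] at hy
      have := (q3 y hy).1
      omega
    obtain ⟨g, g1, g2⟩ := ih (h - (g₀ - bar L g₀))
      (by
        refine mem_Fil_of_top L (sub_mem hh (sub_mem mg (bar_mem_Fil L mg))) ?_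
        intro y hy
        rw [map_sub, map_sub, Finsupp.sub_apply, Finsupp.sub_apply, repr_bar L mg y hy, hg₀,
          q2 y hy, sub_self])
      (by rw [bar_sub, bar_sub, bar_bar, hb]; abel)
    refine ⟨g₀ + g, ?_, ?_⟩
    · intro y
      rw [map_add, Finsupp.add_apply, hg₀]
      exact isNegative_add (q1 y) (g1 y)
    · rw [bar_add]
      calc g₀ + g - (bar L g₀ + bar L g) = (g - bar L g) + (g₀ - bar L g₀) := by abel
        _ = h := by rw [g2]; abel

/-- For every `w` there is exactly one element with the defining properties of `C_w`. -/
theorem existsUnique_isKL [IsOrderedAddMonoid Γ] (L : WeightFunction cs Γ) (w : W) :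
    ∃! C : Hecke L, IsKL L w C := by
  obtain ⟨g, g1, g2⟩ := exists_sub_bar L _ _ (bar_T_sub_mem L w)
    (by rw [bar_sub, bar_bar]; abel)
  refine ⟨T L w + g, ⟨?_, ?_⟩, ?_⟩
  · rw [bar_add]
    calc bar L (T L w) + bar L g = T L w + g + ((bar L (T L w) - T L w) - (g - bar L g)) := by abel
      _ = T L w + g := by rw [g2]; abel
  · intro y
    rw [add_sub_cancel_left]
    exact g1 y
  · rintro C ⟨c1, c2⟩
    have hb : bar L (T L w + g) = T L w + g := by
      rw [bar_add]
      calc bar L (T L w) + bar L g = T L w + g + ((bar L (T L w) - T L w) - (g - bar L g)) := by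
            abel
        _ = T L w + g := by rw [g2]; abel
    rw [← sub_eq_zero]
    refine eq_zero_of_bar_eq L (by rw [bar_sub, c1, hb]) fun y => ?_
    rw [← sub_sub, map_sub, Finsupp.sub_apply]
    exact isNegative_sub (c2 y) (g1 y)

/-- The Kazhdan-Lusztig basis element `C_w`, the unique element satisfying `IsKL L w`. -/
noncomputable def KLelt [IsOrderedAddMonoid Γ] (L : WeightFunction cs Γ) (w : W) : Hecke L :=
  (existsUnique_isKL L w).choose

/-- The canonical symmetrizing form: the `A`-linear map with `τ(T_w) = δ_{1,w}`. -/
noncomputable def tau (L : WeightFunction cs Γ) : Hecke L →ₗ[GroupRing Γ] GroupRing Γ :=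
  (T L).coord 1

end KL

end Hecke

section Longest

variable {B W : Type*} [Group W] {M : CoxeterMatrix B}

/-- `w` is an element of maximal length of the subgroup `H`. -/
def IsLongestIn (cs : CoxeterSystem M W) (H : Subgroup W) (w : W) : Prop :=
  w ∈ H ∧ ∀ u ∈ H, cs.length u ≤ cs.length w

theorem exists_isLongestIn (cs : CoxeterSystem M W) (H : Subgroup W) (N : ℕ)
    (h : ∀ u ∈ H, cs.length u ≤ N) : ∃ w, IsLongestIn cs H w := by
  have hne : (cs.length '' (H : Set W)).Nonempty := ⟨_, 1, H.one_mem, rfl⟩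
  have hb : BddAbove (cs.length '' (H : Set W)) := ⟨N, by rintro _ ⟨u, hu, rfl⟩; exact h u hu⟩
  obtain ⟨w, hw, hw'⟩ := Nat.sSup_mem hne hb
  exact ⟨w, hw, fun u hu => by rw [hw']; exact le_csSup hb ⟨u, hu, rfl⟩⟩

end Longest

section TypeB

/-- The Coxeter matrix of type `B_n`, with the nodes numbered from the double bond: node `0` is `t`
and node `k ≥ 1` is `s_k`. -/
def matB (n : ℕ) : CoxeterMatrix (Fin n) := (CoxeterMatrix.B n).reindex Fin.revPerm

theorem matB_apply (n : ℕ) (i j : Fin n) : matB n i j =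
    if i = j then 1
    else if (i : ℕ) + j = 1 then 4
    else if (i : ℕ) + 1 = j ∨ (j : ℕ) + 1 = i then 3 else 2 := by
  have hi := i.isLt
  have hj := j.isLt
  rw [matB, CoxeterMatrix.reindex_apply]
  simp only [CoxeterMatrix.B, Matrix.of_apply, Fin.revPerm_symm, Fin.revPerm_apply, Fin.ext_iff,
    Fin.val_rev]
  split_ifs <;> omega

/-- The Coxeter group `W_n` of type `B_n`. -/
abbrev WB (n : ℕ) : Type := (matB n).Group

/-- The Coxeter system `(W_n, S_n)`. -/
def csB (n : ℕ) : CoxeterSystem (matB n) (WB n) := (matB n).toCoxeterSystem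

/-- The number `ℓ_t(w)` of occurrences of `t` in a reduced expression of `w`. -/
noncomputable def ellT (n : ℕ) (w : WB n) : ℕ :=
  ((csB n).exists_isReduced w).choose.countP fun i => i.val = 0

/-- The number `ℓ_s(w) = ℓ(w) - ℓ_t(w)`. -/
noncomputable def ellS (n : ℕ) (w : WB n) : ℤ := (csB n).length w - ellT n w

theorem signB_isLiftable (n : ℕ) :
    (matB n).IsLiftable (fun i : Fin n => if i.val = 0 then (-1 : ℤˣ) else 1) := by
  intro i j
  have h4 : ((-1 : ℤˣ)) ^ 4 = 1 := by decide
  have h2 : ((-1 : ℤˣ)) ^ 2 = 1 := by decide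
  rw [matB_apply]
  simp only [Fin.ext_iff]
  by_cases hi : i.val = 0 <;> by_cases hj : j.val = 0
  · simp [hi, hj]
  · rw [if_pos hi, if_neg hj]
    split_ifs <;> first | (exfalso; omega) | simp [h4, h2]
  · rw [if_neg hi, if_pos hj]
    split_ifs <;> first | (exfalso; omega) | simp [h4, h2]
  · simp [hi, hj]

/-- The sign character of `W_n` with `t ↦ -1` and `s_k ↦ 1`. -/
noncomputable def signB (n : ℕ) : WB n →* ℤˣ := (csB n).lift ⟨_, signB_isLiftable n⟩

theorem countP_rightInvSeq (n : ℕ) (ω : List (Fin n)) :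
    ((csB n).rightInvSeq ω).countP (fun r => signB n r = -1) = ω.countP fun i => i.val = 0 := by
  induction ω with
  | nil => rfl
  | cons i ω ih =>
    have h1 : signB n (((csB n).wordProd ω)⁻¹ * (csB n).simple i * (csB n).wordProd ω) =
        if i.val = 0 then (-1 : ℤˣ) else 1 := by
      have h2 : signB n ((csB n).simple i) = if i.val = 0 then (-1 : ℤˣ) else 1 :=
        (csB n).lift_apply_simple (signB_isLiftable n) i
      rw [map_mul, map_mul, map_inv, mul_right_comm, inv_mul_cancel, one_mul, h2]
    have h3 : ((if i.val = 0 then (-1 : ℤˣ) else 1) = -1) ↔ i.val = 0 := by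
      split_ifs with h
      · simp [h]
      · simp only [h, iff_false]; decide
    rw [CoxeterSystem.rightInvSeq, List.countP_cons, List.countP_cons, ih, h1]
    simp only [h3]

theorem ellT_wordProd (n : ℕ) (ω : List (Fin n)) (hω : (csB n).IsReduced ω) :
    ellT n ((csB n).wordProd ω) = ω.countP fun i => i.val = 0 := by
  obtain ⟨h1, h2⟩ := ((csB n).exists_isReduced ((csB n).wordProd ω)).choose_spec
  rw [ellT, ← countP_rightInvSeq, ← countP_rightInvSeq]
  exact (rightInvSeq_perm (csB n) h1 hω h2.symm).countP_eq _

theorem ellT_mul (n : ℕ) (w w' : WB n)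
    (h : (csB n).length (w * w') = (csB n).length w + (csB n).length w') :
    ellT n (w * w') = ellT n w + ellT n w' := by
  obtain ⟨ω, hω, rfl⟩ := (csB n).exists_isReduced w
  obtain ⟨ω', hω', rfl⟩ := (csB n).exists_isReduced w'
  have : (csB n).IsReduced (ω ++ ω') := by
    rw [CoxeterSystem.IsReduced, (csB n).wordProd_append, h, hω.eq, hω'.eq, List.length_append]
  rw [← (csB n).wordProd_append, ellT_wordProd n _ this, ellT_wordProd n _ hω, ellT_wordProd n _ hω',
    List.countP_append]

theorem ellT_simple (n : ℕ) (i : Fin n) :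
    ellT n ((csB n).simple i) = if i.val = 0 then 1 else 0 := by
  have := ellT_wordProd n [i] (by simp [CoxeterSystem.IsReduced])
  simpa [List.countP_cons] using this

/-- The weight function `L_n(w) = (ℓ_t(w), ℓ_s(w))` with values in `ℤ²`, ordered
lexicographically. -/
noncomputable def LB (n : ℕ) : WeightFunction (csB n) (ℤ ×ₗ ℤ) where
  toFun w := toLex ((ellT n w : ℤ), ellS n w)
  map_mul' w w' h := by
    rw [← toLex_add, Prod.mk_add_mk, ellS, ellS, ellS, h, ellT_mul n w w' h]
    push_cast
    congr 2
    ring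
  pos' i := by
    rw [ellS, ellT_simple, (csB n).length_simple, Prod.Lex.lt_iff]
    by_cases h : i.val = 0 <;> simp [h]

/-- The Hecke algebra `H_n` of type `B_n`, over `A = ℤ[V, V⁻¹, v, v⁻¹]`. -/
abbrev HB (n : ℕ) : Type := Hecke (LB n)

/-- The power `V ^ k` of `V = v ^ (1, 0)`. -/
noncomputable def Vpow (k : ℤ) : GroupRing (ℤ ×ₗ ℤ) := vpow (toLex (k, 0))

/-- The generators: `sB n 0 = t` and `sB n k = s_k` for `1 ≤ k ≤ n - 1` (and `1` for `k ≥ n`, which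
is never used). -/
noncomputable def sB (n k : ℕ) : WB n := if h : k < n then (csB n).simple ⟨k, h⟩ else 1

/-- `r_1 = t` and `r_{i+1} = s_i r_i`. -/
noncomputable def rB (n : ℕ) : ℕ → WB n
  | 0 => 1
  | 1 => sB n 0
  | i + 2 => sB n (i + 1) * rB n (i + 1)

/-- `t_1 = t` and `t_{i+1} = s_i t_i s_i`. -/
noncomputable def tB (n : ℕ) : ℕ → WB n
  | 0 => 1
  | 1 => sB n 0
  | i + 2 => sB n (i + 1) * tB n (i + 1) * sB n (i + 1)

/-- `a_l = r_1 r_2 ⋯ r_l`. -/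
noncomputable def aB (n l : ℕ) : WB n := ((List.range l).map fun i => rB n (i + 1)).prod

/-- The parabolic subgroup `𝔖_l` of `W_n`, generated by `s_1, …, s_{l-1}`. -/
def symB (n l : ℕ) : Subgroup (WB n) :=
  Subgroup.closure {w | ∃ k : Fin n, 1 ≤ k.val ∧ k.val < l ∧ w = (csB n).simple k}

theorem sB_sq (n k : ℕ) : sB n k * sB n k = 1 := by
  rw [sB]; split_ifs <;> simp

theorem sB_comm (n i k : ℕ) (h : i + 2 ≤ k) (hk : k < n) (hi : 1 ≤ i) :
    sB n i * sB n k = sB n k * sB n i := by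
  have h1 := (csB n).simple_mul_simple_pow ⟨i, by omega⟩ ⟨k, hk⟩
  rw [matB_apply, if_neg (by simp; omega), if_neg (by simp; omega), if_neg (by simp; omega)] at h1
  rw [sB, dif_pos (by omega : i < n), sB, dif_pos hk]
  rw [pow_two, mul_eq_one_iff_eq_inv, mul_inv_rev, (csB n).inv_simple, (csB n).inv_simple] at h1
  exact h1

theorem sB_braid (n i : ℕ) (hi : 1 ≤ i) (hk : i + 1 < n) :
    sB n (i + 1) * sB n i * sB n (i + 1) = sB n i * sB n (i + 1) * sB n i := by
  have h1 := (csB n).simple_mul_simple_pow ⟨i + 1, hk⟩ ⟨i, by omega⟩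
  rw [matB_apply, if_neg (by simp), if_neg (by simp; omega), if_pos (by simp)] at h1
  rw [sB, dif_pos hk, sB, dif_pos (by omega : i < n)]
  have h2 : (csB n).simple ⟨i + 1, hk⟩ * (csB n).simple ⟨i, by omega⟩ *
      (csB n).simple ⟨i + 1, hk⟩ * ((csB n).simple ⟨i, by omega⟩ *
      (csB n).simple ⟨i + 1, hk⟩ * (csB n).simple ⟨i, by omega⟩) = 1 := by
    rw [← h1, pow_succ, pow_two]
    simp only [mul_assoc]
  rw [mul_eq_one_iff_eq_inv] at h2
  rw [h2]
  simp [mul_assoc]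

/-- `s_l s_{l-1} ⋯ s_{l-j+1}`. -/
noncomputable def cosetB (n l : ℕ) : ℕ → WB n
  | 0 => 1
  | j + 1 => cosetB n l j * sB n (l - j)

theorem cosetB_comm (n l i j : ℕ) (hl : l < n) (hi : 1 ≤ i) (h : i + j < l) :
    cosetB n l j * sB n i = sB n i * cosetB n l j := by
  induction j with
  | zero => simp [cosetB]
  | succ j ih =>
    rw [cosetB, mul_assoc, ← sB_comm n i (l - j) (by omega) (by omega) hi, ← mul_assoc,
      ih (by omega), mul_assoc]

theorem cosetB_braid (n l i j : ℕ) (hl : l < n) (hj : j ≤ l) (hi : i + 1 ≤ l) (h : l < i + j) :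
    cosetB n l j * sB n (i + 1) = sB n i * cosetB n l j := by
  induction j with
  | zero => omega
  | succ j ih =>
    by_cases h1 : l < i + j
    · rw [cosetB, mul_assoc, sB_comm n (l - j) (i + 1) (by omega) (by omega) (by omega),
        ← mul_assoc, ih (by omega) h1, mul_assoc]
    · obtain ⟨j, rfl⟩ : ∃ k, j = k + 1 := ⟨j - 1, by omega⟩
      rw [cosetB, cosetB]
      have e1 : l - (j + 1) = i := by omega
      have e2 : l - j = i + 1 := by omega
      rw [e1, e2, mul_assoc, mul_assoc, ← mul_assoc (sB n (i + 1)), sB_braid n i (by omega)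
        (by omega), mul_assoc (sB n i), ← mul_assoc, cosetB_comm n l i j hl (by omega) (by omega)]
      simp only [mul_assoc]

theorem sB_mem (n l k : ℕ) (hk : 1 ≤ k) (hkl : k < l) (hn : k < n) : sB n k ∈ symB n l :=
  Subgroup.subset_closure ⟨⟨k, hn⟩, hk, hkl, by rw [sB, dif_pos hn]⟩

theorem symB_coset (n l : ℕ) (hl : l < n) (w : WB n) (hw : w ∈ symB n (l + 1)) :
    ∃ u ∈ symB n l, ∃ j ≤ l, w = u * cosetB n l j := by
  have step : ∀ (x y : WB n), y ∈ {w | ∃ k : Fin n, 1 ≤ k.val ∧ k.val < l + 1 ∧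
      w = (csB n).simple k} → (∃ u ∈ symB n l, ∃ j ≤ l, x = u * cosetB n l j) →
      ∃ u ∈ symB n l, ∃ j ≤ l, x * y = u * cosetB n l j := by
    rintro _ _ ⟨k, hk1, hk2, rfl⟩ ⟨u, hu, j, hj, rfl⟩
    have hs : (csB n).simple k = sB n k.val := by rw [sB, dif_pos k.isLt]
    rw [hs, mul_assoc]
    rcases lt_trichotomy (k.val + j) l with h | h | h
    · exact ⟨u * sB n k, mul_mem hu (sB_mem n l k hk1 (by omega) k.isLt), j, hj, by
        rw [cosetB_comm n l k j hl hk1 h, mul_assoc]⟩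
    · exact ⟨u, hu, j + 1, by omega, by rw [cosetB, show l - j = k.val by omega]⟩
    · obtain ⟨j, rfl⟩ : ∃ i, j = i + 1 := ⟨j - 1, by omega⟩
      by_cases h1 : k.val + j = l
      · exact ⟨u, hu, j, by omega, by
          rw [cosetB, show l - j = k.val by omega, mul_assoc, sB_sq, mul_one]⟩
      · obtain ⟨k', hk'⟩ : ∃ i, k.val = i + 1 := ⟨k.val - 1, by omega⟩
        refine ⟨u * sB n k', mul_mem hu (sB_mem n l k' (by omega) (by omega) (by omega)), j + 1,
          hj, ?_⟩
        rw [hk', cosetB_braid n l k' (j + 1) hl hj (by omega) (by omega), mul_assoc]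
  induction hw using Subgroup.closure_induction_right with
  | one => exact ⟨1, one_mem _, 0, by omega, by simp [cosetB]⟩
  | mul_right x _ y hy ih => exact step x y hy ih
  | mul_inv_cancel x _ y hy ih =>
    refine step x y⁻¹ ?_ ih
    obtain ⟨k, h1, h2, rfl⟩ := hy
    exact ⟨k, h1, h2, (csB n).inv_simple k⟩

theorem symB_bounded (n l : ℕ) : ∃ N, ∀ u ∈ symB n l, (csB n).length u ≤ N := by
  induction l with
  | zero =>
    refine ⟨0, fun u hu => ?_⟩
    rw [symB] at hu
    simp at hu
    simp [hu]
  | succ l ih =>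
    obtain ⟨N, hN⟩ := ih
    by_cases hl : l < n
    · refine ⟨N + ∑ j ∈ Finset.range (l + 1), (csB n).length (cosetB n l j), fun w hw => ?_⟩
      obtain ⟨u, hu, j, hj, rfl⟩ := symB_coset n l hl w hw
      refine ((csB n).length_mul_le _ _).trans (add_le_add (hN u hu) ?_)
      exact Finset.single_le_sum (f := fun j => (csB n).length (cosetB n l j))
        (fun _ _ => Nat.zero_le _) (Finset.mem_range.mpr (by omega))
    · refine ⟨N, fun u hu => hN u ?_⟩
      refine Subgroup.closure_mono ?_ hu
      rintro _ ⟨k, h1, h2, rfl⟩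
      have := k.isLt
      exact ⟨k, h1, by omega, rfl⟩

theorem exists_longest_symB (n l : ℕ) : ∃ w, IsLongestIn (csB n) (symB n l) w :=
  (symB_bounded n l).elim fun N hN => exists_isLongestIn _ _ N hN

/-- The longest element `σ_l` of `𝔖_l`. -/
noncomputable def sigmaB (n l : ℕ) : WB n := (exists_longest_symB n l).choose

/-- `P_l = (T_{t_1} + V⁻¹) (T_{t_2} + V⁻¹) ⋯ (T_{t_l} + V⁻¹)`. -/
noncomputable def PB (n l : ℕ) : HB n :=
  ((List.range l).map fun i =>
    T (LB n) (tB n (i + 1)) + algebraMap (GroupRing (ℤ ×ₗ ℤ)) (HB n) (Vpow (-1))).prod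

/-- The Kazhdan-Lusztig basis element `C_w` of `H_n`. -/
noncomputable def CB (n : ℕ) (w : WB n) : HB n := KLelt (LB n) w

/-- The inverse `T_w⁻¹` in `H_n`. -/
noncomputable def TinvB (n : ℕ) (w : WB n) : HB n := (((TUnit (LB n) w)⁻¹ : (HB n)ˣ) : HB n)

end TypeB

end CoxeterKL

/-! Write `E_l = P_l T_{σ_l}⁻¹`. Since `C_{a_l}` is characterised by bar-invariance and negativity
of its lower coefficients, the first claim amounts to checking these two properties for `E_l`. Both
checks are inductions on `l`.

In the Hecke algebra, `T_{t_i}` is the Jucys-Murphy element `J_i = g_{i-1} ⋯ g_1 g_0 g_1 ⋯ g_{i-1}`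
in the generators `g_0 = T_t`, `g_k = T_{s_k}`. The `J_i` commute with each other, and a product of
the `J_i + V⁻¹` for `i ≤ l` commutes with `g_j` for `1 ≤ j < l`, because `g_j` commutes with the
symmetric expression `(J_j + V⁻¹)(J_{j+1} + V⁻¹)`. Hence `P_l` commutes with `T_{σ_l}`. As `σ_{l+1}
= (s_l ⋯ s_1)⁻¹ σ_l` with lengths adding, one obtains the recursion `E_{l+1} = E_l (T_{r_{l+1}} +
V⁻¹ g_l⁻¹ ⋯ g_1⁻¹)` (`PB_mul_TinvB_succ`).

Bar-invariance: the bar of the new factor differs from the factor by `-(g_l ⋯ g_1 - g_l⁻¹ ⋯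
g_1⁻¹)(g_0 - V)`, and this is killed by `P_l` on the left
(`BraidRelations.shiftedProd_mul_desc_sub`). The source of the vanishing is `(T_t + V⁻¹)(T_t - V) =
0`.

Triangularity: right multiplication by `T_{r_{l+1}}` sends `T_y` to `T_{y r_{l+1}}` for `y` in the
parabolic subgroup of type `B_l`, and the `g_k⁻¹` with `k ≥ 1` have coefficients of `V`-degree 0. So
`E_l - T_{a_l}` has all coefficients of `V`-degree at most -1. In the lexicographic order this is
stronger than lying in `A_{<0}`, and it survives multiplication by elements of `V`-degree at most 0
in the algebra of `𝔖_n`. Together with `ℓ(a_l σ) = ℓ(a_l) + ℓ(σ)` and the fact that `C_σ` is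
supported on `𝔖_n` (`KLelt_mem_spanT`), this gives `C_{a_l} C_σ = C_{a_l σ}`.

Trace: in `P_{l+1} h = P_l T_{t_{l+1}} h + V⁻¹ P_l h` with `h` supported on `𝔖_n`, the first term is
supported off `𝔖_n`, so each factor of `P_l` contributes one `V⁻¹` to `τ` (`tau_PB_mul`).

The length formulas rest on two estimates for the action of `W_n` by signed permutations
(`pathCoord_sub_le_length`, `negSum_le_length`), combined with length additivity for minimal coset
representatives (`length_mul_of_minimal`). -/

namespace CoxeterKL

/-! ### Minimal coset representatives of parabolic subgroups -/

section Coset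

variable {B W : Type*} [Group W] {M : CoxeterMatrix B} (cs : CoxeterSystem M W)

theorem rightInvSeq_append (ω ψ : List B) :
    cs.rightInvSeq (ω ++ ψ) =
      (cs.rightInvSeq ω).map (fun r => (cs.wordProd ψ)⁻¹ * r * cs.wordProd ψ) ++
        cs.rightInvSeq ψ := by
  induction ω with
  | nil => simp
  | cons i ω ih =>
    rw [List.cons_append, CoxeterSystem.rightInvSeq, CoxeterSystem.rightInvSeq, ih, List.map_cons,
      List.cons_append, cs.wordProd_append]
    congr 1
    group

/-- The parity of the multiplicity of a reflection depends only on the product of the word. Without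
repetitions the multiplicities are 0 or 1, so they agree with those of a reduced word, and the two
words have equal length. -/
theorem isReduced_of_nodup_rightInvSeq {ω : List B} (h : (cs.rightInvSeq ω).Nodup) :
    cs.IsReduced ω := by
  classical
  obtain ⟨ψ, hψ, e⟩ := cs.exists_isReduced (cs.wordProd ω)
  have hp : (cs.rightInvSeq ω).Perm (cs.rightInvSeq ψ) := by
    rw [List.perm_iff_count]
    intro r
    have h1 := List.nodup_iff_count_le_one.mp h r
    have h2 := List.nodup_iff_count_le_one.mp hψ.nodup_rightInvSeq r
    have h3 := count_rightInvSeq_congr cs e r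
    rw [ZMod.natCast_eq_natCast_iff'] at h3
    omega
  have := hp.length_eq
  rw [cs.length_rightInvSeq, cs.length_rightInvSeq] at this
  rw [CoxeterSystem.IsReduced, e, hψ.eq, this]

variable {S : Set W}

/-- An element of the parabolic subgroup has some word in letters of `S`, possibly not reduced, and
every inversion read off that word lies in the subgroup. A reflection occurring once in `ω` occurs
an odd number of times in that word. -/
theorem rightInvSeq_subset_of_mem_closure (hS : ∀ s ∈ S, ∃ i, s = cs.simple i)
    {ω : List B} (hω : cs.IsReduced ω) (h : cs.wordProd ω ∈ Subgroup.closure S) :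
    ∀ r ∈ cs.rightInvSeq ω, r ∈ Subgroup.closure S := by
  classical
  obtain ⟨ψ, e, hψ⟩ : ∃ ψ : List B, cs.wordProd ω = cs.wordProd ψ ∧
      ∀ r ∈ cs.rightInvSeq ψ, r ∈ Subgroup.closure S := by
    clear hω
    generalize cs.wordProd ω = w at h ⊢
    have step : ∀ x y, y ∈ S → (∃ ψ : List B, x = cs.wordProd ψ ∧
        ∀ r ∈ cs.rightInvSeq ψ, r ∈ Subgroup.closure S) →
        ∃ ψ : List B, x * y = cs.wordProd ψ ∧
        ∀ r ∈ cs.rightInvSeq ψ, r ∈ Subgroup.closure S := by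
      rintro _ y hy ⟨ψ, rfl, h⟩
      obtain ⟨i, rfl⟩ := hS y hy
      have hi := Subgroup.subset_closure hy
      refine ⟨ψ ++ [i], by simp [cs.wordProd_append], ?_⟩
      intro r hr
      rw [rightInvSeq_append, List.mem_append, List.mem_map] at hr
      rcases hr with ⟨q, hq, rfl⟩ | hr
      · rw [cs.wordProd_singleton]
        exact mul_mem (mul_mem (inv_mem hi) (h q hq)) hi
      · rw [cs.rightInvSeq_singleton, List.mem_singleton] at hr
        rwa [hr]
    induction h using Subgroup.closure_induction_right with
    | one => exact ⟨[], by simp, by simp⟩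
    | mul_right x _ y hy ih => exact step x y hy ih
    | mul_inv_cancel x _ y hy ih =>
      obtain ⟨i, rfl⟩ := hS y hy
      rw [cs.inv_simple]
      exact step x _ hy ih
  intro r hr
  apply hψ
  have h1 := List.nodup_iff_count_le_one.mp hω.nodup_rightInvSeq r
  have h3 := count_rightInvSeq_congr cs e r
  rw [ZMod.natCast_eq_natCast_iff'] at h3
  have h4 := List.count_pos_iff.mpr hr
  exact List.count_pos_iff.mp (by omega)

/-- If `d` has minimal length in its coset `H d`, where `H` is a standard parabolic subgroup, then
`ℓ(yd) = ℓ(y) + ℓ(d)` for all `y ∈ H`. -/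
theorem length_mul_of_minimal (hS : ∀ s ∈ S, ∃ i, s = cs.simple i) {y d : W} (hy : y ∈ Subgroup.closure S)
    (hd : ∀ u ∈ Subgroup.closure S, cs.length d ≤ cs.length (u * d)) :
    cs.length (y * d) = cs.length y + cs.length d := by
  obtain ⟨ω, hω, rfl⟩ := cs.exists_isReduced y
  obtain ⟨ψ, hψ, rfl⟩ := cs.exists_isReduced d
  have : cs.IsReduced (ω ++ ψ) := by
    apply isReduced_of_nodup_rightInvSeq
    rw [rightInvSeq_append, List.nodup_append]
    refine ⟨hω.nodup_rightInvSeq.map ?_, hψ.nodup_rightInvSeq, ?_⟩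
    · intro a b h
      simpa using h
    · rintro _ h1 r hr rfl
      obtain ⟨q, hq, rfl⟩ := List.mem_map.mp h1
      -- A repetition would be a right inversion `r` of `d` with `d r = q d` and `q` in the
      -- parabolic subgroup; then `q d` is shorter than `d`, against minimality.
      have h2 := (cs.isRightInversion_of_mem_rightInvSeq hψ hr).2
      have h3 := hd q (rightInvSeq_subset_of_mem_closure cs hS hω hy q hq)
      have e : cs.wordProd ψ * ((cs.wordProd ψ)⁻¹ * q * cs.wordProd ψ) = q * cs.wordProd ψ := by
        group
      rw [e] at h2
      omega
  rw [← cs.wordProd_append, this.eq, hω.eq, hψ.eq, List.length_append]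

theorem length_mul_of_minimal_right (hS : ∀ s ∈ S, ∃ i, s = cs.simple i)
    {y d : W} (hy : y ∈ Subgroup.closure S)
    (hd : ∀ u ∈ Subgroup.closure S, cs.length d ≤ cs.length (u * d⁻¹)) :
    cs.length (d * y) = cs.length d + cs.length y := by
  have := length_mul_of_minimal cs hS (y := y⁻¹) (d := d⁻¹) (inv_mem hy)
    (fun u hu => (cs.length_inv d).le.trans (hd u hu))
  rw [← mul_inv_rev, cs.length_inv, cs.length_inv, cs.length_inv] at this
  omega

end Coset

/-! ### Signed permutations satisfy the Coxeter relations of type `B_n` -/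

section SignedPerm

/-- The action of the generators of `W_n` on `ℤ` by signed permutations. -/
def signedStep (k : ℕ) (x : ℤ) : ℤ :=
  if k = 0 then (if x = 1 then -1 else if x = -1 then 1 else x)
  else if x = k then k + 1 else if x = k + 1 then k
  else if x = -k then -k - 1 else if x = -k - 1 then -k else x

theorem signedStep_neg (k : ℕ) (x : ℤ) : signedStep k (-x) = -signedStep k x := by
  by_cases hk : k = 0
  · simp only [signedStep, if_pos hk]
    split_ifs <;> omega
  · simp only [signedStep, if_neg hk]
    split_ifs <;> omega

theorem signedStep_zero_one : signedStep 0 1 = -1 := by simp [signedStep]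

theorem signedStep_zero_neg_one : signedStep 0 (-1) = 1 := by simp [signedStep]

theorem signedStep_zero_of_ne {x : ℤ} (h1 : x ≠ 1) (h2 : x ≠ -1) : signedStep 0 x = x := by
  simp [signedStep, h1, h2]

theorem signedStep_up {k : ℕ} {x : ℤ} (hk : 1 ≤ k) (h : x = k) : signedStep k x = k + 1 := by
  rw [signedStep, if_neg (by omega), if_pos h]

theorem signedStep_down {k : ℕ} {x : ℤ} (hk : 1 ≤ k) (h : x = k + 1) : signedStep k x = k := by
  rw [signedStep, if_neg (by omega), if_neg (by omega), if_pos h]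

theorem signedStep_neg_up {k : ℕ} {x : ℤ} (hk : 1 ≤ k) (h : x = -k) :
    signedStep k x = -k - 1 := by
  rw [signedStep, if_neg (by omega), if_neg (by omega), if_neg (by omega), if_pos h]

theorem signedStep_neg_down {k : ℕ} {x : ℤ} (hk : 1 ≤ k) (h : x = -k - 1) :
    signedStep k x = -k := by
  rw [signedStep, if_neg (by omega), if_neg (by omega), if_neg (by omega), if_neg (by omega),
    if_pos h]

theorem signedStep_of_ne {k : ℕ} {x : ℤ} (hk : 1 ≤ k) (h : x ≠ k ∧ x ≠ k + 1)
    (h' : x ≠ -k ∧ x ≠ -k - 1) : signedStep k x = x := by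
  rw [signedStep, if_neg (by omega), if_neg h.1, if_neg h.2, if_neg h'.1, if_neg h'.2]

theorem signedStep_involutive (k : ℕ) : Function.Involutive (signedStep k) := by
  intro x
  rcases Nat.eq_zero_or_pos k with rfl | hk
  · by_cases h1 : x = 1
    · rw [h1, signedStep_zero_one, signedStep_zero_neg_one]
    by_cases h2 : x = -1
    · rw [h2, signedStep_zero_neg_one, signedStep_zero_one]
    rw [signedStep_zero_of_ne h1 h2, signedStep_zero_of_ne h1 h2]
  · have key : (x = k ∨ x = k + 1 ∨ x = -k ∨ x = -k - 1 ∨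
      (x ≠ k ∧ x ≠ k + 1) ∧ (x ≠ -k ∧ x ≠ -k - 1)) := by omega
    rcases key with h | h | h | h | h
    · rw [signedStep_up hk h, signedStep_down hk rfl, h]
    · rw [signedStep_down hk h, signedStep_up hk rfl, h]
    · rw [signedStep_neg_up hk h, signedStep_neg_down hk rfl, h]
    · rw [signedStep_neg_down hk h, signedStep_neg_up hk rfl, h]
    · rw [signedStep_of_ne hk h.1 h.2, signedStep_of_ne hk h.1 h.2]

theorem signedStep_fix {k : ℕ} {x : ℤ} (h : (k : ℤ) + 1 < x) : signedStep k x = x := by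
  rcases Nat.eq_zero_or_pos k with rfl | hk
  · exact signedStep_zero_of_ne (by omega) (by omega)
  · exact signedStep_of_ne hk (by omega) (by omega)

theorem signedStep_comm (i j : ℕ) (h : i + 2 ≤ j) (x : ℤ) :
    signedStep i (signedStep j x) = signedStep j (signedStep i x) := by
  have key : ∀ x : ℤ, (x = j ∨ x = j + 1 ∨ x = -j ∨ x = -j - 1 ∨
      (x ≠ j ∧ x ≠ j + 1) ∧ (x ≠ -j ∧ x ≠ -j - 1)) := by intro x; omega
  rcases Nat.eq_zero_or_pos i with rfl | hi
  · rcases key x with h1 | h1 | h1 | h1 | h1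
    · simp (disch := omega) only [signedStep_up, signedStep_zero_of_ne]
    · simp (disch := omega) only [signedStep_down, signedStep_zero_of_ne]
    · simp (disch := omega) only [signedStep_neg_up, signedStep_zero_of_ne]
    · simp (disch := omega) only [signedStep_neg_down, signedStep_zero_of_ne]
    · rw [signedStep_of_ne (by omega) h1.1 h1.2]
      by_cases h2 : x = 1
      · rw [h2, signedStep_zero_one, signedStep_of_ne] <;> omega
      by_cases h3 : x = -1
      · rw [h3, signedStep_zero_neg_one, signedStep_of_ne] <;> omega
      rw [signedStep_zero_of_ne h2 h3, signedStep_of_ne (by omega) h1.1 h1.2]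
  · have key' : (x = i ∨ x = i + 1 ∨ x = -i ∨ x = -i - 1 ∨
      (x ≠ i ∧ x ≠ i + 1) ∧ (x ≠ -i ∧ x ≠ -i - 1)) := by omega
    rcases key x with h1 | h1 | h1 | h1 | h1
    · simp (disch := omega) only [signedStep_up, signedStep_of_ne]
    · simp (disch := omega) only [signedStep_down, signedStep_of_ne]
    · simp (disch := omega) only [signedStep_neg_up, signedStep_of_ne]
    · simp (disch := omega) only [signedStep_neg_down, signedStep_of_ne]
    rw [signedStep_of_ne (by omega) h1.1 h1.2]
    rcases key' with h2 | h2 | h2 | h2 | h2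
    · simp (disch := omega) only [signedStep_up, signedStep_of_ne]
    · simp (disch := omega) only [signedStep_down, signedStep_of_ne]
    · simp (disch := omega) only [signedStep_neg_up, signedStep_of_ne]
    · simp (disch := omega) only [signedStep_neg_down, signedStep_of_ne]
    · rw [signedStep_of_ne (by omega) h2.1 h2.2, signedStep_of_ne (by omega) h1.1 h1.2]

theorem signedStep_braid (i : ℕ) (h : 1 ≤ i) (x : ℤ) :
    signedStep i (signedStep (i + 1) (signedStep i x)) =
      signedStep (i + 1) (signedStep i (signedStep (i + 1) x)) := by
  have key : x = i ∨ x = i + 1 ∨ x = i + 2 ∨ x = -i ∨ x = -i - 1 ∨ x = -i - 2 ∨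
      (x ≠ i ∧ x ≠ i + 1 ∧ x ≠ i + 2 ∧ x ≠ -i ∧ x ≠ -i - 1 ∧ x ≠ -i - 2) := by omega
  rcases key with h1 | h1 | h1 | h1 | h1 | h1 | h1 <;>
  simp (disch := omega) only [signedStep_up, signedStep_down, signedStep_neg_up,
      signedStep_neg_down, signedStep_of_ne] <;> push_cast <;> ring

theorem signedStep_braid_zero (x : ℤ) :
    signedStep 0 (signedStep 1 (signedStep 0 (signedStep 1 x))) =
      signedStep 1 (signedStep 0 (signedStep 1 (signedStep 0 x))) := by
  have key : x = 1 ∨ x = 2 ∨ x = -1 ∨ x = -2 ∨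
      (x ≠ 1 ∧ x ≠ 2 ∧ x ≠ -1 ∧ x ≠ -2) := by omega
  rcases key with rfl | rfl | rfl | rfl | h1
  · decide
  · decide
  · decide
  · decide
  · simp (disch := omega) only [signedStep_zero_of_ne, signedStep_of_ne]

/-- `signedStep` as a permutation of `ℤ`. -/
def signedGen (k : ℕ) : Equiv.Perm ℤ := (signedStep_involutive k).toPerm

theorem signedGen_sq (k : ℕ) : signedGen k * signedGen k = 1 :=
  Equiv.ext fun x => signedStep_involutive k x

/-- Only the existence of the action is needed: it serves to bound lengths from below and to
separate elements, and its faithfulness plays no role. -/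
theorem signedGen_isLiftable (n : ℕ) :
    (matB n).IsLiftable (fun i : Fin n => signedGen i.val) := by
  have hbr : ∀ i, 1 ≤ i → signedGen i * signedGen (i + 1) * signedGen i =
      signedGen (i + 1) * signedGen i * signedGen (i + 1) := fun i h =>
    Equiv.ext fun x => signedStep_braid i h x
  have h4 : signedGen 0 * signedGen 1 * signedGen 0 * signedGen 1 =
      signedGen 1 * signedGen 0 * signedGen 1 * signedGen 0 :=
    Equiv.ext fun x => signedStep_braid_zero x
  have hc : ∀ i j, i + 2 ≤ j → signedGen i * signedGen j = signedGen j * signedGen i :=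
    fun i j h => Equiv.ext fun x => signedStep_comm i j h x
  have hi : ∀ k, signedGen k = (signedGen k)⁻¹ := fun k =>
    eq_inv_of_mul_eq_one_left (signedGen_sq k)
  -- For involutions `ba` is the inverse of `ab`, so the relations need checking only for `i < j`.
  have flip : ∀ (a b : Equiv.Perm ℤ) (k : ℕ), a = a⁻¹ → b = b⁻¹ → (a * b) ^ k = 1 →
      (b * a) ^ k = 1 := by
    intro a b k ha hb h
    rw [ha, hb, ← mul_inv_rev, inv_pow, h, inv_one]
  have p2 : ∀ i j, i + 2 ≤ j → (signedGen i * signedGen j) ^ 2 = 1 := by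
    intro i j h
    rw [pow_two]
    nth_rw 2 [hc i j h]
    rw [mul_assoc, ← mul_assoc (signedGen j), signedGen_sq, one_mul, signedGen_sq]
  have p3 : ∀ i, 1 ≤ i → (signedGen i * signedGen (i + 1)) ^ 3 = 1 := by
    intro i h
    have : (signedGen i * signedGen (i + 1)) ^ 3 = signedGen i * signedGen (i + 1) * signedGen i *
        (signedGen (i + 1) * signedGen i * signedGen (i + 1)) := by
      simp only [pow_succ, pow_zero, one_mul, mul_assoc]
    rw [this, ← hbr i h]
    simp only [mul_assoc]
    rw [← mul_assoc (signedGen i) (signedGen i), signedGen_sq, one_mul,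
      ← mul_assoc (signedGen (i + 1)) (signedGen (i + 1)), signedGen_sq, one_mul, signedGen_sq]
  have p4 : (signedGen 0 * signedGen 1) ^ 4 = 1 := by
    have : (signedGen 0 * signedGen 1) ^ 4 = signedGen 0 * signedGen 1 * signedGen 0 *
        signedGen 1 * (signedGen 0 * signedGen 1 * signedGen 0 * signedGen 1) := by
      simp only [pow_succ, pow_zero, one_mul, mul_assoc]
    rw [this]
    nth_rw 1 [h4]
    simp only [mul_assoc]
    rw [← mul_assoc (signedGen 0) (signedGen 0), signedGen_sq, one_mul,
      ← mul_assoc (signedGen 1) (signedGen 1), signedGen_sq, one_mul,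
      ← mul_assoc (signedGen 0) (signedGen 0), signedGen_sq, one_mul, signedGen_sq]
  have main : ∀ i j : Fin n, i < j → (signedGen i * signedGen j) ^ (matB n i j) = 1 := by
    rintro ⟨i, hi⟩ ⟨j, hj⟩ h
    rw [Fin.mk_lt_mk] at h
    rw [matB_apply]
    simp only [Fin.mk.injEq]
    rw [if_neg (by omega)]
    by_cases h1 : i + j = 1
    · obtain ⟨rfl, rfl⟩ : i = 0 ∧ j = 1 := by omega
      simpa using p4
    rw [if_neg h1]
    by_cases h2 : i + 1 = j
    · subst h2
      rw [if_pos (Or.inl rfl)]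
      exact p3 i (by omega)
    · rw [if_neg (by omega)]
      exact p2 i j (by omega)
  intro i j
  rcases lt_trichotomy i j with h | rfl | h
  · exact main i j h
  · rw [matB_apply, if_pos rfl, pow_one, signedGen_sq]
  · rw [(matB n).symmetric]
    exact flip _ _ _ (hi _) (hi _) (main j i h)

end SignedPerm

/-! ### The signed action and two lower bounds for the length -/

section SignedAction

/-- The action of `W_n` on `ℤ` by signed permutations. -/
noncomputable def signedAction (n : ℕ) : WB n →* Equiv.Perm ℤ :=
  (csB n).lift ⟨_, signedGen_isLiftable n⟩

theorem signedAction_simple (n : ℕ) (k : Fin n) (x : ℤ) :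
    signedAction n ((csB n).simple k) x = signedStep k x :=
  DFunLike.congr_fun ((csB n).lift_apply_simple (signedGen_isLiftable n) k) x

theorem signedAction_sB {n k : ℕ} (hk : k < n) (x : ℤ) :
    signedAction n (sB n k) x = signedStep k x := by
  rw [sB, dif_pos hk, signedAction_simple]

theorem signedAction_mul (n : ℕ) (w w' : WB n) (x : ℤ) :
    signedAction n (w * w') x = signedAction n w (signedAction n w' x) := by
  rw [map_mul, Equiv.Perm.mul_apply]

theorem signedAction_inv_apply {n : ℕ} {w : WB n} {x y : ℤ} (h : signedAction n w x = y) :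
    signedAction n w⁻¹ y = x := by
  rw [map_inv, ← h]
  exact Equiv.symm_apply_apply _ _

/-- The parabolic subgroup of type `B_l` of `W_n`. -/
def parB (n l : ℕ) : Subgroup (WB n) :=
  Subgroup.closure {w | ∃ k : Fin n, k.val < l ∧ w = (csB n).simple k}

theorem symB_le_parB (n l : ℕ) : symB n l ≤ parB n l :=
  Subgroup.closure_mono fun _ ⟨k, _, h, e⟩ => ⟨k, h, e⟩

theorem symB_mono (n : ℕ) {l m : ℕ} (h : l ≤ m) : symB n l ≤ symB n m :=
  Subgroup.closure_mono fun _ ⟨k, h1, h2, e⟩ => ⟨k, h1, by omega, e⟩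

theorem sB_mem_parB {n l k : ℕ} (hkl : k < l) (hn : k < n) : sB n k ∈ parB n l :=
  Subgroup.subset_closure ⟨⟨k, hn⟩, hkl, by rw [sB, dif_pos hn]⟩

theorem signedAction_of_mem_parB {n l : ℕ} {w : WB n} (hw : w ∈ parB n l) {x : ℤ} (hx : l < x) :
    signedAction n w x = x := by
  induction hw using Subgroup.closure_induction with
  | mem w h =>
    obtain ⟨k, hk, rfl⟩ := h
    rw [signedAction_simple, signedStep_fix (by omega)]
  | one => simp
  | mul a b _ _ ha hb => rw [signedAction_mul, hb, ha]
  | inv a _ ha => exact signedAction_inv_apply ha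

theorem signedAction_neg (n : ℕ) (w : WB n) (x : ℤ) :
    signedAction n w (-x) = -signedAction n w x := by
  obtain ⟨ω, -, rfl⟩ := (csB n).exists_isReduced w
  induction ω with
  | nil => simp
  | cons i ω ih =>
    rw [(csB n).wordProd_cons, signedAction_mul, signedAction_mul, ih, signedAction_simple,
      signedAction_simple, signedStep_neg]

/-- The generators `s_k` permute the positive integers among themselves; only `t` changes signs. -/
theorem signedAction_neg_iff_of_mem_symB {n l : ℕ} {w : WB n} (hw : w ∈ symB n l) (x : ℤ) :
    signedAction n w x < 0 ↔ x < 0 := by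
  induction hw using Subgroup.closure_induction generalizing x with
  | mem w h =>
    obtain ⟨k, hk, -, rfl⟩ := h
    rw [signedAction_simple, signedStep, if_neg (by omega)]
    split_ifs <;> omega
  | one => simp
  | mul a b _ _ ha hb => rw [signedAction_mul, ha, hb]
  | inv a _ ha =>
    rw [← ha (signedAction n a⁻¹ x), ← signedAction_mul, mul_inv_cancel]
    simp

/-- The position of a nonzero integer on the path `…, 3, 2, 1, -1, -2, -3, …`. -/
def pathCoord (x : ℤ) : ℤ := if 0 < x then x else x + 1

/-- On the path `…, 2, 1, -1, -2, …` both `s_k` and `t` exchange neighbours only. -/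
theorem pathCoord_signedStep (k : ℕ) (x : ℤ) : |pathCoord (signedStep k x) - pathCoord x| ≤ 1 := by
  rw [abs_le]
  by_cases hk : k = 0
  · simp only [signedStep, if_pos hk, pathCoord]
    split_ifs <;> omega
  · simp only [signedStep, if_neg hk, pathCoord]
    split_ifs <;> omega

/-- Each letter moves a point by at most one step. This is the lower bound behind the lengths of
`cosetB`, `rB` and `tB`, each of which carries one well-chosen point as far as its word permits. -/
theorem pathCoord_sub_le_length (n : ℕ) (w : WB n) (x : ℤ) :
    |pathCoord (signedAction n w x) - pathCoord x| ≤ (csB n).length w := by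
  obtain ⟨ω, hω, rfl⟩ := (csB n).exists_isReduced w
  rw [hω.eq]
  clear hω
  induction ω with
  | nil => simp
  | cons i ω ih =>
    rw [(csB n).wordProd_cons, signedAction_mul, signedAction_simple, List.length_cons]
    have := pathCoord_signedStep i (signedAction n ((csB n).wordProd ω) x)
    push_cast
    rw [abs_le] at *
    omega

/-- The sum of the `i` in `{1, …, n}` that `w` sends to a negative number. -/
noncomputable def negSum (n : ℕ) (w : WB n) : ℤ :=
  ∑ i ∈ Finset.Icc (1 : ℤ) n, if signedAction n w i < 0 then i else 0

/-- Right multiplication by `t` affects only the term `i = 1`; right multiplication by `s_k`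
exchanges the roles of `k` and `k + 1`. Either way the sum grows by at most one. -/
theorem negSum_mul_simple (n : ℕ) (w : WB n) (k : Fin n) :
    negSum n (w * (csB n).simple k) ≤ negSum n w + 1 := by
  have hk := k.isLt
  -- The spare unit is put on the single term that may grow: `i = 1` for `t` (where `k = 0`) and `i
  -- = k` for `s_k`, that is, `i = max 1 k`.
  have hb : negSum n w + 1 = ∑ i ∈ Finset.Icc (1 : ℤ) n, ((if signedAction n w i < 0 then i else 0)
      + if i = max 1 (k : ℤ) then 1 else 0) := by
    rw [Finset.sum_add_distrib, Finset.sum_ite_eq', if_pos (by rw [Finset.mem_Icc]; omega), negSum]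
  rw [hb]
  by_cases hk0 : k.val = 0
  · refine Finset.sum_le_sum fun i hi => ?_
    rw [Finset.mem_Icc] at hi
    rw [signedAction_mul, signedAction_simple, hk0]
    by_cases h1 : i = 1
    · rw [if_pos (by omega : i = max 1 ((0 : ℕ) : ℤ))]
      split_ifs <;> omega
    · rw [signedStep_zero_of_ne h1 (by omega)]
      split_ifs <;> omega
  -- Reindexing the sum by the involution `s_k` leaves the condition on `w` unchanged and moves the
  -- effect of `s_k` into the summand.
  · have e : negSum n (w * (csB n).simple k) =
        ∑ i ∈ Finset.Icc (1 : ℤ) n, if signedAction n w i < 0 then signedStep k i else 0 := by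
      have hmem : ∀ i ∈ Finset.Icc (1 : ℤ) n, signedStep k i ∈ Finset.Icc (1 : ℤ) n := by
        intro i hi
        rw [Finset.mem_Icc] at hi ⊢
        rw [signedStep, if_neg hk0]
        split_ifs <;> omega
      refine Finset.sum_nbij' (signedStep k) (signedStep k) hmem hmem
        (fun i _ => signedStep_involutive k i) (fun i _ => signedStep_involutive k i) ?_
      intro i _
      rw [signedAction_mul, signedAction_simple, signedStep_involutive k i]
    rw [e]
    refine Finset.sum_le_sum fun i hi => ?_
    rw [Finset.mem_Icc] at hi
    have : signedStep k i ≤ i + if i = max 1 (k : ℤ) then 1 else 0 := by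
      rw [signedStep, if_neg hk0]
      split_ifs <;> omega
    split_ifs at this ⊢ <;> omega

theorem negSum_le_length (n : ℕ) (w : WB n) : negSum n w ≤ (csB n).length w := by
  obtain ⟨ω, hω, rfl⟩ := (csB n).exists_isReduced w
  rw [hω.eq]
  clear hω
  induction ω using List.reverseRecOn with
  | nil =>
    refine (Finset.sum_eq_zero fun i hi => ?_).le
    rw [Finset.mem_Icc] at hi
    rw [(csB n).wordProd_nil, map_one, Equiv.Perm.one_apply, if_neg (by omega)]
  | append_singleton ω i ih =>
    rw [(csB n).wordProd_append, (csB n).wordProd_singleton, List.length_append]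
    have := negSum_mul_simple n ((csB n).wordProd ω) i
    push_cast
    simp only [List.length_singleton, Nat.cast_one]
    omega

/-- This makes `negSum` constant on cosets `𝔖_l w`, so it bounds the length of every element of such
a coset at once. -/
theorem negSum_mul_of_mem_symB {n l : ℕ} {u : WB n} (hu : u ∈ symB n l) (w : WB n) :
    negSum n (u * w) = negSum n w := by
  refine Finset.sum_congr rfl fun i _ => ?_
  rw [signedAction_mul]
  simp only [signedAction_neg_iff_of_mem_symB hu]

end SignedAction

/-! ### Lengths of the elements `r_l`, `t_l`, `a_l` and the recursion for `σ_l` -/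

section Lengths

theorem length_sB_mul_le (n k : ℕ) (w : WB n) :
    (csB n).length (sB n k * w) ≤ (csB n).length w + 1 := by
  rw [sB]
  split_ifs with h
  · have := (csB n).length_mul_le ((csB n).simple ⟨k, h⟩) w
    rw [(csB n).length_simple] at this
    omega
  · simp

theorem length_mul_sB_le (n k : ℕ) (w : WB n) :
    (csB n).length (w * sB n k) ≤ (csB n).length w + 1 := by
  rw [sB]
  split_ifs with h
  · have := (csB n).length_mul_le w ((csB n).simple ⟨k, h⟩)
    rw [(csB n).length_simple] at this
    omega
  · simp

theorem length_cosetB_le (n l j : ℕ) : (csB n).length (cosetB n l j) ≤ j := by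
  induction j with
  | zero => simp [cosetB]
  | succ j ih => exact (length_mul_sB_le _ _ _).trans (by omega)

theorem signedAction_cosetB {n l j : ℕ} (hl : l < n) (hj : j ≤ l) :
    signedAction n (cosetB n l j) (l + 1 - j) = l + 1 := by
  induction j with
  | zero => simp [cosetB]
  | succ j ih =>
    rw [cosetB, signedAction_mul, signedAction_sB (by omega),
      signedStep_up (by omega) (by push_cast [Nat.cast_sub (by omega : j ≤ l)]; ring)]
    rw [← ih (by omega)]
    congr 1
    push_cast [Nat.cast_sub (by omega : j ≤ l)]
    ring

/-- For `y` in the parabolic subgroup of type `B_l`, which fixes `l + 1`, the element `y * cosetB n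
l j` carries `l + 1 - j` to `l + 1`, so it has length at least `j`. As `cosetB n l j` is a product
of `j` generators, it is minimal in its coset. -/
theorem length_mul_cosetB {n l j : ℕ} (hl : l < n) (hj : j ≤ l) {u : WB n} (hu : u ∈ parB n l) :
    (csB n).length (u * cosetB n l j) = (csB n).length u + j := by
  have low : ∀ y ∈ parB n l, j ≤ (csB n).length (y * cosetB n l j) := by
    intro y hy
    have := pathCoord_sub_le_length n (y * cosetB n l j) (l + 1 - j)
    rw [signedAction_mul, signedAction_cosetB hl hj,
      signedAction_of_mem_parB hy (by omega), pathCoord, pathCoord,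
      if_pos (by omega), if_pos (by omega), abs_le] at this
    omega
  have e : (csB n).length (cosetB n l j) = j :=
    le_antisymm (length_cosetB_le n l j) (by simpa using low 1 (one_mem _))
  rw [length_mul_of_minimal (csB n) (S := {w | ∃ k : Fin n, k.val < l ∧
    w = (csB n).simple k}) (fun _ ⟨k, _, h⟩ => ⟨k, h⟩) hu (fun y hy => ?_), e]
  rw [e]
  exact low y hy

theorem length_cosetB {n l j : ℕ} (hl : l < n) (hj : j ≤ l) :
    (csB n).length (cosetB n l j) = j := by
  simpa using length_mul_cosetB hl hj (one_mem (parB n l))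

theorem length_rB_le (n l : ℕ) : (csB n).length (rB n l) ≤ l := by
  induction l with
  | zero => simp [rB]
  | succ l ih =>
    cases l with
    | zero => simpa [rB] using length_mul_sB_le n 0 1
    | succ l => exact (length_sB_mul_le _ _ _).trans (by omega)

theorem signedAction_rB_one {n l : ℕ} (hl : l < n) :
    signedAction n (rB n (l + 1)) 1 = -(l + 1) := by
  induction l with
  | zero => rw [rB, signedAction_sB hl, signedStep_zero_one]; simp
  | succ l ih =>
    rw [rB, signedAction_mul, ih (by omega), signedAction_sB hl,
      signedStep_neg_up (by omega) (by push_cast; ring)]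
    push_cast
    ring

theorem rB_mem_parB {n l m : ℕ} (hm : m < l) (hl : l ≤ n) : rB n (m + 1) ∈ parB n l := by
  induction m with
  | zero => exact sB_mem_parB (by omega) (by omega)
  | succ m ih => exact mul_mem (sB_mem_parB (by omega) (by omega)) (ih (by omega))

theorem signedAction_rB {n l : ℕ} (hl : l < n) {x : ℤ} (hx : 2 ≤ x) (hx' : x ≤ l + 1) :
    signedAction n (rB n (l + 1)) x = x - 1 := by
  induction l with
  | zero => omega
  | succ l ih =>
    rw [rB, signedAction_mul]
    rcases eq_or_lt_of_le hx' with h | h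
    · have : signedAction n (rB n (l + 1)) x = x :=
        signedAction_of_mem_parB (rB_mem_parB (l := l + 1) (by omega) (by omega))
          (by push_cast at h ⊢; omega)
      rw [this, signedAction_sB hl, signedStep_down (by omega) (by omega)]
      omega
    · rw [ih (by omega) (by omega), signedAction_sB hl, signedStep_of_ne (by omega)] <;> omega

/-- The point `1` is carried to `-(l + 1)`, a path distance of `l + 1`, by every element of the
coset of `r_{l+1}`, which is therefore minimal there. -/
theorem length_mul_rB {n l : ℕ} (hl : l < n) {y : WB n} (hy : y ∈ parB n l) :
    (csB n).length (y * rB n (l + 1)) = (csB n).length y + (l + 1) := by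
  have low : ∀ y ∈ parB n l, l + 1 ≤ (csB n).length (y * rB n (l + 1)) := by
    intro y hy
    have := pathCoord_sub_le_length n (y * rB n (l + 1)) 1
    rw [signedAction_mul, signedAction_rB_one hl, signedAction_neg,
      signedAction_of_mem_parB hy (by omega), pathCoord, pathCoord,
      if_neg (by omega), if_pos (by omega), abs_le] at this
    omega
  have e : (csB n).length (rB n (l + 1)) = l + 1 :=
    le_antisymm (length_rB_le n _) (by simpa using low 1 (one_mem _))
  rw [length_mul_of_minimal (csB n) (S := {w | ∃ k : Fin n, k.val < l ∧
    w = (csB n).simple k}) (fun _ ⟨k, _, h⟩ => ⟨k, h⟩) hy (fun y hy => ?_), e]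
  rw [e]
  exact low y hy

theorem length_rB {n l : ℕ} (hl : l < n) : (csB n).length (rB n (l + 1)) = l + 1 := by
  simpa using length_mul_rB hl (one_mem (parB n l))

/-- The element makes `1` negative, which no element of `𝔖_n` does. -/
theorem mul_rB_notMem_symB {n l : ℕ} (hl : l < n) {y : WB n} (hy : y ∈ parB n l) :
    y * rB n (l + 1) ∉ symB n n := by
  intro h
  have := signedAction_neg_iff_of_mem_symB h 1
  rw [signedAction_mul, signedAction_rB_one hl, signedAction_neg,
      signedAction_of_mem_parB hy (by omega)] at this
  omega

theorem length_tB_le (n l : ℕ) : (csB n).length (tB n (l + 1)) ≤ 2 * l + 1 := by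
  induction l with
  | zero => simpa [tB] using length_mul_sB_le n 0 1
  | succ l ih =>
    rw [tB]
    refine (length_mul_sB_le _ _ _).trans ?_
    have := length_sB_mul_le n (l + 1) (tB n (l + 1))
    omega

theorem signedAction_tB {n l : ℕ} (hl : l < n) :
    signedAction n (tB n (l + 1)) (l + 1) = -(l + 1) := by
  induction l with
  | zero => rw [tB, signedAction_sB hl]; simpa using signedStep_zero_one
  | succ l ih =>
    rw [tB, signedAction_mul, signedAction_mul, signedAction_sB hl (((l + 1 : ℕ) : ℤ) + 1),
      signedStep_down (by omega) (by simp), Nat.cast_succ, ih (by omega), signedAction_sB hl,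
      signedStep_neg_up (by omega) (by simp)]
    push_cast
    ring

/-- Every element of the coset carries `l + 1` to `-(l + 1)`, at path distance `2l + 1`. -/
theorem length_mul_tB {n l : ℕ} (hl : l < n) {y : WB n} (hy : y ∈ parB n l) :
    (csB n).length (y * tB n (l + 1)) = (csB n).length y + (2 * l + 1) := by
  have low : ∀ y ∈ parB n l, 2 * l + 1 ≤ (csB n).length (y * tB n (l + 1)) := by
    intro y hy
    have h := pathCoord_sub_le_length n (y * tB n (l + 1)) (l + 1)
    rw [signedAction_mul, signedAction_tB hl, signedAction_neg,
      signedAction_of_mem_parB hy (by omega), pathCoord, pathCoord, if_neg (by omega),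
      if_pos (by omega), abs_le] at h
    omega
  have e : (csB n).length (tB n (l + 1)) = 2 * l + 1 :=
    le_antisymm (length_tB_le n l) (by simpa using low 1 (one_mem _))
  rw [length_mul_of_minimal (csB n) (S := {w | ∃ k : Fin n, k.val < l ∧
    w = (csB n).simple k}) (fun _ ⟨k, _, h⟩ => ⟨k, h⟩) hy (fun y hy => ?_), e]
  rw [e]
  exact low y hy

theorem length_tB {n l : ℕ} (hl : l < n) : (csB n).length (tB n (l + 1)) = 2 * l + 1 := by
  simpa using length_mul_tB hl (one_mem (parB n l))

theorem aB_succ (n l : ℕ) : aB n (l + 1) = aB n l * rB n (l + 1) := by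
  simp [aB, List.range_succ]

theorem aB_mem_parB {n l : ℕ} (hl : l ≤ n) : aB n l ∈ parB n l := by
  refine list_prod_mem fun x hx => ?_
  obtain ⟨i, hi, rfl⟩ := List.mem_map.mp hx
  exact rB_mem_parB (List.mem_range.mp hi) hl

theorem signedAction_aB {n l : ℕ} (hl : l ≤ n) {x : ℤ} (hx : 1 ≤ x) (hx' : x ≤ l) :
    signedAction n (aB n l) (-x) = l + 1 - x := by
  induction l generalizing x with
  | zero => omega
  | succ l ih =>
    rw [aB_succ, signedAction_mul, signedAction_neg n (rB n (l + 1))]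
    rcases eq_or_lt_of_le hx with rfl | h
    · rw [signedAction_rB_one (by omega), neg_neg,
        signedAction_of_mem_parB (aB_mem_parB (by omega)) (by omega)]
      push_cast
      ring
    · rw [signedAction_rB (by omega) (by omega) (by push_cast at hx'; omega),
        ih (by omega) (by omega) (by push_cast at hx'; omega)]
      push_cast
      ring

theorem length_aB_le (n l : ℕ) :
    ((csB n).length (aB n l) : ℤ) ≤ ∑ i ∈ Finset.Icc (1 : ℤ) l, i := by
  induction l with
  | zero => simp [aB]
  | succ l ih =>
    have e : Finset.Icc (1 : ℤ) (l + 1 : ℕ) = insert ((l : ℤ) + 1) (Finset.Icc (1 : ℤ) l) := by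
      ext x
      simp only [Finset.mem_Icc, Finset.mem_insert]
      push_cast
      omega
    rw [e, Finset.sum_insert (by simp), aB_succ]
    have h1 := (csB n).length_mul_le (aB n l) (rB n (l + 1))
    have h2 := length_rB_le n (l + 1)
    omega

theorem sum_le_negSum_inv_aB {n l : ℕ} (hl : l ≤ n) :
    ∑ i ∈ Finset.Icc (1 : ℤ) l, i ≤ negSum n (aB n l)⁻¹ := by
  rw [negSum]
  refine (Finset.sum_le_sum fun i hi => ?_).trans (Finset.sum_le_sum_of_subset_of_nonneg
    (Finset.Icc_subset_Icc_right (by exact_mod_cast hl)) fun i hi _ => ?_)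
  · rw [Finset.mem_Icc] at hi
    -- Since `a_l` maps `-x` to `l + 1 - x`, the preimage of `i` is found with `x = l + 1 - i`; it
    -- is negative for every `1 ≤ i ≤ l`.
    rw [signedAction_inv_apply (signedAction_aB hl (x := l + 1 - i) (by omega) (by omega)
      |>.trans (by ring : _ = i)), if_pos (by omega)]
  · rw [Finset.mem_Icc] at hi
    split_ifs <;> omega

/-- On the coset `𝔖_n a_l⁻¹` the statistic `negSum` is constant and at least `1 + ⋯ + l ≥ ℓ(a_l)`,
so `a_l⁻¹` is minimal in it. -/
theorem length_aB_mul {n l : ℕ} (hl : l ≤ n) {u : WB n} (hu : u ∈ symB n n) :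
    (csB n).length (aB n l * u) = (csB n).length (aB n l) + (csB n).length u := by
  refine length_mul_of_minimal_right (csB n) (S := {w | ∃ k : Fin n, 1 ≤ k.val ∧ k.val < n ∧
    w = (csB n).simple k}) (fun _ ⟨k, _, _, h⟩ => ⟨k, h⟩) hu fun y hy => ?_
  have h1 := negSum_le_length n (y * (aB n l)⁻¹)
  rw [negSum_mul_of_mem_symB (l := n) hy] at h1
  have h2 := length_aB_le n l
  have h3 := sum_le_negSum_inv_aB hl
  omega

theorem cosetB_mem_symB {n l j : ℕ} (hl : l < n) (hj : j ≤ l) : cosetB n l j ∈ symB n (l + 1) := by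
  induction j with
  | zero => exact one_mem _
  | succ j ih => exact mul_mem (ih (by omega)) (sB_mem n _ _ (by omega) (by omega) (by omega))

theorem cosetB_succ (n l j : ℕ) :
    cosetB n (l + 1) (j + 1) = sB n (l + 1) * cosetB n l j := by
  induction j with
  | zero => simp [cosetB]
  | succ j ih => rw [cosetB, ih, cosetB, mul_assoc, Nat.add_sub_add_right]

theorem sigmaB_spec (n l : ℕ) : IsLongestIn (csB n) (symB n l) (sigmaB n l) :=
  (exists_longest_symB n l).choose_spec

/-- In the factorisation `w = u * cosetB n l j` lengths add, so maximality forces both `j = l` and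
the maximality of `u`. -/
theorem isLongestIn_symB_succ {n l : ℕ} (hl : l < n) {w : WB n}
    (hw : IsLongestIn (csB n) (symB n (l + 1)) w) :
    ∃ u, IsLongestIn (csB n) (symB n l) u ∧ w = u * cosetB n l l := by
  obtain ⟨u, hu, j, hj, rfl⟩ := symB_coset n l hl w hw.1
  have h : ∀ y ∈ symB n l, (csB n).length y + l ≤ (csB n).length u + j := by
    intro y hy
    rw [← length_mul_cosetB hl hj (symB_le_parB n l hu),
      ← length_mul_cosetB hl le_rfl (symB_le_parB n l hy)]
    exact hw.2 _ (mul_mem (symB_mono n (Nat.le_succ l) hy) (cosetB_mem_symB hl le_rfl))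
  -- Comparison with the competitor `u * cosetB n l l` gives `l ≤ j`.
  have hjl : j = l := by have := h u hu; omega
  subst hjl
  exact ⟨u, ⟨hu, fun y hy => by have := h y hy; omega⟩, rfl⟩

/-- Uniqueness of the longest element, by peeling off the forced factor `cosetB n l l`. It is what
makes `σ_l` an involution and gives its recursion. -/
theorem eq_sigmaB {n l : ℕ} (hl : l ≤ n) {w : WB n} (hw : IsLongestIn (csB n) (symB n l) w) :
    w = sigmaB n l := by
  induction l generalizing w with
  | zero =>
    have : ∀ u ∈ symB n 0, u = 1 := by
      intro u hu
      simpa [symB] using hu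
    rw [this _ hw.1, this _ (sigmaB_spec n 0).1]
  | succ l ih =>
    obtain ⟨u, hu, rfl⟩ := isLongestIn_symB_succ hl hw
    obtain ⟨u', hu', e⟩ := isLongestIn_symB_succ hl (sigmaB_spec n (l + 1))
    rw [e, ih (by omega) hu, ih (by omega) hu']

theorem sigmaB_inv {n l : ℕ} (hl : l ≤ n) : (sigmaB n l)⁻¹ = sigmaB n l :=
  eq_sigmaB hl ⟨inv_mem (sigmaB_spec n l).1, fun u hu => by
    rw [(csB n).length_inv]; exact (sigmaB_spec n l).2 u hu⟩

theorem sigmaB_succ {n l : ℕ} (hl : l < n) :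
    sigmaB n (l + 1) = sigmaB n l * cosetB n l l := by
  obtain ⟨u', hu', e⟩ := isLongestIn_symB_succ hl (sigmaB_spec n (l + 1))
  rw [e, eq_sigmaB hl.le hu']

end Lengths

/-! ### Jucys-Murphy elements in a group with the braid relations of type `B_n` -/

section JucysMurphy

/-- The braid relations of type `B_n` for a sequence of group elements. -/
structure BraidRelations {G : Type*} [Group G] (n : ℕ) (g : ℕ → G) : Prop where
  comm : ∀ i k, i + 2 ≤ k → k < n → Commute (g i) (g k)
  braid : ∀ i, 1 ≤ i → i + 1 < n → g (i + 1) * g i * g (i + 1) = g i * g (i + 1) * g i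
  braid_zero : 1 < n → g 0 * g 1 * g 0 * g 1 = g 1 * g 0 * g 1 * g 0

variable {G : Type*} [Group G] (g : ℕ → G)

/-- The Jucys-Murphy elements `g_{i-1} ⋯ g_1 g_0 g_1 ⋯ g_{i-1}`. -/
def jucysMurphy : ℕ → G
  | 0 => 1
  | 1 => g 0
  | i + 2 => g (i + 1) * jucysMurphy (i + 1) * g (i + 1)

/-- The product `g_l ⋯ g_1`. -/
def descProd : ℕ → G
  | 0 => 1
  | l + 1 => g (l + 1) * descProd l

variable {g} {n : ℕ}

theorem BraidRelations.commute_jucysMurphy_of_lt (hg : BraidRelations n g) {i j : ℕ} (hij : i < j)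
    (hj : j < n) : Commute (g j) (jucysMurphy g i) := by
  induction i with
  | zero => exact Commute.one_right _
  | succ i ih =>
    cases i with
    | zero => exact (hg.comm 0 j (by omega) hj).symm
    | succ i =>
      have h := (hg.comm (i + 1) j (by omega) hj).symm
      exact (h.mul_right (ih (by omega))).mul_right h

/-- The critical case is `i = j + 1`: the braid relation carries `g_j` through the outer factors
`g_{j+1} g_j` as `g_{j+1}`, which commutes with the inner Jucys-Murphy element, and back again. For
`j = 0` this is the relation of order 4. Larger `i` only adds outer factors commuting with `g_j`. -/
theorem BraidRelations.commute_jucysMurphy (hg : BraidRelations n g) {i j : ℕ} (hij : j < i)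
    (hi : i < n) : Commute (g j) (jucysMurphy g (i + 1)) := by
  induction i with
  | zero => omega
  | succ i ih =>
    rcases Nat.lt_succ_iff_lt_or_eq.mp hij with h | rfl
    · have h1 := hg.comm j (i + 1) (by omega) hi
      exact (h1.mul_right (ih h (by omega))).mul_right h1
    · cases j with
      | zero =>
        have h := hg.braid_zero hi
        change g 0 * (g 1 * g 0 * g 1) = g 1 * g 0 * g 1 * g 0
        rw [← h]
        simp only [mul_assoc]
      | succ j =>
        have h := hg.braid (j + 1) (by omega) hi
        have hc := hg.commute_jucysMurphy_of_lt (i := j + 1) (j := j + 2) (by omega) hi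
        change g (j + 1) * (g (j + 2) * (g (j + 1) * jucysMurphy g (j + 1) * g (j + 1)) *
          g (j + 2)) = g (j + 2) * (g (j + 1) * jucysMurphy g (j + 1) * g (j + 1)) * g (j + 2) *
          g (j + 1)
        generalize jucysMurphy g (j + 1) = x at hc ⊢
        calc _ = (g (j + 1) * g (j + 2) * g (j + 1)) * x * (g (j + 1) * g (j + 2)) := by
              simp only [mul_assoc]
          _ = g (j + 2) * g (j + 1) * (g (j + 2) * x) * (g (j + 1) * g (j + 2)) := by
              rw [← h]; simp only [mul_assoc]
          _ = g (j + 2) * g (j + 1) * x * (g (j + 2) * g (j + 1) * g (j + 2)) := by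
              rw [hc.eq]; simp only [mul_assoc]
          _ = _ := by rw [h]; simp only [mul_assoc]

theorem BraidRelations.commute_jucysMurphy_jucysMurphy (hg : BraidRelations n g) {i j : ℕ}
    (hij : i < j) (hj : j ≤ n) : Commute (jucysMurphy g i) (jucysMurphy g j) := by
  obtain ⟨j, rfl⟩ : ∃ k, j = k + 1 := ⟨j - 1, by omega⟩
  induction i with
  | zero => exact Commute.one_left _
  | succ i ih =>
    have h := hg.commute_jucysMurphy (i := j) (j := i) (by omega) (by omega)
    cases i with
    | zero => exact h
    | succ i => exact (h.mul_left (ih (by omega))).mul_left h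

end JucysMurphy

/-! ### Products of shifted Jucys-Murphy elements under a quadratic relation -/

section ShiftedProduct

variable {A R : Type*} [CommRing A] [Ring R] [Algebra A R] {g : ℕ → Rˣ} {n : ℕ}

/-- The product of the Jucys-Murphy elements shifted by a scalar `z`. -/
def shiftedProd (g : ℕ → Rˣ) (z : A) (l : ℕ) : R :=
  ((List.range l).map fun i => ((jucysMurphy g (i + 1) : Rˣ) : R) + algebraMap A R z).prod

theorem shiftedProd_succ (g : ℕ → Rˣ) (z : A) (l : ℕ) :
    shiftedProd g z (l + 1) =
      shiftedProd g z l * (((jucysMurphy g (l + 1) : Rˣ) : R) + algebraMap A R z) := by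
  simp [shiftedProd, List.range_succ]

theorem BraidRelations.commute_shiftedProd_of_lt (hg : BraidRelations n g) (z : A) {l j : ℕ}
    (hl : l < j) (hj : j < n) : Commute (g j : R) (shiftedProd g z l) := by
  induction l with
  | zero => exact Commute.one_right _
  | succ l ih =>
    rw [shiftedProd_succ]
    exact (ih (by omega)).mul_right (((hg.commute_jucysMurphy_of_lt hl hj).units_val).add_right
      (Algebra.commutes z _).symm)

/-- The product expands into `x · txt`, `x + txt` and central terms. The quadratic relation makes
`t` commute with `x + txt`, and the commutation of `x` with `txt` makes `t` commute with `x · txt`.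
-/
theorem commute_mul_add_of_quadratic {t x z ξ : R} (hz : ∀ y, Commute z y) (hξ : ∀ y, Commute ξ y)
    (ht : t * t = 1 + ξ * t) (hx : Commute x (t * x * t)) :
    Commute t ((x + z) * (t * x * t + z)) := by
  have h1 : Commute t (x * (t * x * t)) := by
    have : t * (x * (t * x * t)) = t * x * t * x * t := by simp only [mul_assoc]
    rw [Commute, SemiconjBy, this, hx.eq]
  have h2 : Commute t (x + t * x * t) := by
    have e1 : t * (t * x * t) = x * t + ξ * (t * x * t) := by
      rw [← mul_assoc, ← mul_assoc, ht]
      noncomm_ring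
    have e2 : t * x * t * t = t * x + ξ * (t * x * t) := by
      rw [mul_assoc (t * x), ht, mul_add, mul_one, ← mul_assoc (t * x), ← (hξ (t * x)).eq]
      simp only [mul_assoc]
    rw [Commute, SemiconjBy, mul_add, add_mul, e1, e2]
    abel
  have e : (x + z) * (t * x * t + z) = x * (t * x * t) + z * (x + t * x * t) + z * z := by
    rw [add_mul, mul_add, mul_add, ← (hz x).eq, mul_add]
    abel
  rw [e]
  exact (h1.add_right ((hz t).symm.mul_right h2)).add_right ((hz t).symm.mul_right (hz t).symm)

variable {ξ : ℕ → A}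

/-- All factors commute with `g_j` individually, except those of `J_j` and `J_{j+1} = g_j J_j g_j`,
whose product is symmetric enough to commute with `g_j` by `commute_mul_add_of_quadratic`. -/
theorem BraidRelations.commute_shiftedProd (hg : BraidRelations n g)
    (hq : ∀ i < n, (g i : R) * g i = 1 + algebraMap A R (ξ i) * g i) (z : A) {l j : ℕ}
    (hj : 1 ≤ j) (hjl : j < l) (hl : l ≤ n) : Commute (g j : R) (shiftedProd g z l) := by
  induction l with
  | zero => omega
  | succ l ih =>
    rcases Nat.lt_succ_iff_lt_or_eq.mp hjl with h | rfl
    · rw [shiftedProd_succ]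
      exact (ih h (by omega)).mul_right (((hg.commute_jucysMurphy h hl).units_val).add_right
        (Algebra.commutes z _).symm)
    · obtain ⟨j, rfl⟩ : ∃ i, j = i + 1 := ⟨j - 1, by omega⟩
      rw [shiftedProd_succ, shiftedProd_succ, mul_assoc]
      refine (hg.commute_shiftedProd_of_lt z (by omega) (by omega)).mul_right ?_
      have e : ((jucysMurphy g (j + 1 + 1) : Rˣ) : R) = g (j + 1) * (jucysMurphy g (j + 1) : Rˣ) * g (j + 1) := by
        rw [jucysMurphy]; simp
      have hc := (hg.commute_jucysMurphy_jucysMurphy (i := j + 1) (j := j + 2) (by omega)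
        (by omega)).units_val
      rw [e] at hc ⊢
      exact commute_mul_add_of_quadratic (fun y => Algebra.commutes z y)
        (fun y => Algebra.commutes (ξ (j + 1)) y) (hq _ (by omega)) hc

/-- The first factor gives `(g_0 + z)(g_0 - V) = 0`, the quadratic relation for `g_0`; all later
factors commute with `g_0`. -/
theorem BraidRelations.shiftedProd_mul_sub (hg : BraidRelations n g)
    (hq : ∀ i < n, (g i : R) * g i = 1 + algebraMap A R (ξ i) * g i) {z V : A} (hz : z * V = 1)
    (hξ : ξ 0 = V - z) {l : ℕ} (hl : 1 ≤ l) (hln : l ≤ n) :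
    shiftedProd g z l * ((g 0 : R) - algebraMap A R V) = 0 := by
  obtain ⟨l, rfl⟩ : ∃ k, l = k + 1 := ⟨l - 1, by omega⟩
  clear hl
  induction l with
  | zero =>
    have h1 := hq 0 (by omega)
    rw [hξ] at h1
    have h2 : algebraMap A R z * algebraMap A R V = 1 := by rw [← map_mul, hz, map_one]
    have h3 := Algebra.commutes V (g 0 : R)
    rw [shiftedProd_succ]
    simp only [shiftedProd, List.range_zero, List.map_nil, List.prod_nil, one_mul,
      jucysMurphy]
    rw [add_mul, mul_sub, mul_sub, h1, h2, map_sub, ← h3, sub_mul]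
    abel
  | succ l ih =>
    have hc : Commute (((jucysMurphy g (l + 1 + 1) : Rˣ) : R) + algebraMap A R z)
        ((g 0 : R) - algebraMap A R V) := by
      refine Commute.add_left (Commute.sub_right ?_ ?_) (Algebra.commutes z _)
      · exact (hg.commute_jucysMurphy (i := l + 1) (j := 0) (by omega) (by omega)).symm.units_val
      · exact (Algebra.commutes V _).symm
    rw [shiftedProd_succ, mul_assoc, hc.eq, ← mul_assoc, ih (by omega), zero_mul]

/-- Replacing each `g_k` by `g_k⁻¹ + ξ_k`, from the left, expresses the difference of the two
descending products through shorter products `g_{k-1} ⋯ g_1`. These commute with the shifted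
product, which then meets `g_0 - V` and vanishes. The element `u` accumulates the inverses already
split off; it commutes with all generators still to come. -/
theorem BraidRelations.shiftedProd_mul_desc_sub (hg : BraidRelations n g)
    (hq : ∀ i < n, (g i : R) * g i = 1 + algebraMap A R (ξ i) * g i) {z V : A} (hz : z * V = 1)
    (hξ : ξ 0 = V - z) {l m : ℕ} (hm : m ≤ l) (hln : l < n) {u : R}
    (hu : ∀ j < m, Commute u (g j)) :
    shiftedProd g z l * u * (((descProd g m : Rˣ) : R) - (descProd (fun i => (g i)⁻¹) m : Rˣ)) *
      ((g 0 : R) - algebraMap A R V) = 0 := by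
  induction m generalizing u with
  | zero => simp [descProd]
  | succ m ih =>
    have e : ((descProd g (m + 1) : Rˣ) : R) - (descProd (fun i => (g i)⁻¹) (m + 1) : Rˣ) =
        ((g (m + 1))⁻¹ : Rˣ) * (((descProd g m : Rˣ) : R) - (descProd (fun i => (g i)⁻¹) m : Rˣ)) +
          algebraMap A R (ξ (m + 1)) * (descProd g m : Rˣ) := by
      have h : (g (m + 1) : R) = ((g (m + 1))⁻¹ : Rˣ) + algebraMap A R (ξ (m + 1)) := by
        have := congrArg (fun x => x * (((g (m + 1))⁻¹ : Rˣ) : R)) (hq (m + 1) (by omega))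
        simpa [mul_assoc, add_mul] using this
      rw [descProd, descProd, Units.val_mul, Units.val_mul]
      nth_rw 1 [h]
      rw [add_mul, mul_sub]
      abel
    -- The factor `g_{m+1}⁻¹` is absorbed into `u`; it commutes with `g_j` for `j < m` because these
    -- indices are at least two apart.
    have h1 := ih (by omega) (u := u * ((g (m + 1))⁻¹ : Rˣ)) fun j hj =>
      (hu j (by omega)).mul_left ((hg.comm j (m + 1) (by omega) (by omega)).symm.inv_left.units_val)
    have hD : ∀ (x : R) k, (∀ j, 1 ≤ j → j ≤ k → Commute x (g j)) → Commute x ((descProd g k : Rˣ) : R) := by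
      intro x k h
      induction k with
      | zero => exact Commute.one_right _
      | succ k ih =>
        rw [descProd, Units.val_mul]
        exact (h _ (by omega) le_rfl).mul_right (ih fun j hj hjk => h j hj (by omega))
    have c1 : Commute u ((descProd g m : Rˣ) : R) := hD _ _ fun j _ hj => hu j (by omega)
    have c2 : Commute (shiftedProd g z l) ((descProd g m : Rˣ) : R) := hD _ _ fun j hj hjm =>
      (hg.commute_shiftedProd hq z hj (by omega) hln.le).symm
    have c3 : Commute u ((g 0 : R) - algebraMap A R V) :=
      (hu 0 (by omega)).sub_right (Algebra.commutes V u).symm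
    -- Moving `g_m ⋯ g_1` to the left and `u` to the right brings the shifted product next to `g_0 -
    -- V`. Commuting the former past the shifted product needs `m < l`, which holds as `m + 1 ≤ l`.
    have h2 : shiftedProd g z l * u * (descProd g m : Rˣ) * ((g 0 : R) - algebraMap A R V) = 0 := by
      rw [mul_assoc (shiftedProd g z l), c1.eq, ← mul_assoc, c2.eq, mul_assoc, c3.eq, mul_assoc,
        ← mul_assoc (shiftedProd g z l), hg.shiftedProd_mul_sub hq hz hξ (by omega) hln.le,
        zero_mul, mul_zero]
    rw [e, mul_add, add_mul, ← mul_assoc (shiftedProd g z l * u),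
      mul_assoc (shiftedProd g z l) u, h1, zero_add, ← Algebra.smul_def, mul_smul_comm,
      smul_mul_assoc, h2, smul_zero]

/-- The identity behind the invariance of `C_{a_l}` under the semilinear involution. -/
theorem BraidRelations.shiftedProd_mul_eq (hg : BraidRelations n g)
    (hq : ∀ i < n, (g i : R) * g i = 1 + algebraMap A R (ξ i) * g i) {z V : A} (hz : z * V = 1)
    (hξ : ξ 0 = V - z) {l : ℕ} (hln : l < n) :
    shiftedProd g z l * (((descProd (fun i => (g i)⁻¹) l : Rˣ) : R) *
        ((g 0 : R) - algebraMap A R (ξ 0)) + algebraMap A R V * (descProd g l : Rˣ)) =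
      shiftedProd g z l * (((descProd g l : Rˣ) : R) * g 0 +
        algebraMap A R z * (descProd (fun i => (g i)⁻¹) l : Rˣ)) := by
  have h := hg.shiftedProd_mul_desc_sub hq hz hξ le_rfl hln (u := 1)
    (fun j _ => Commute.one_left _)
  rw [mul_one, mul_assoc] at h
  -- With `ξ_0 = V - z`, the bracket on the left minus the one on the right is `-(g_l ⋯ g_1 - g_l⁻¹
  -- ⋯ g_1⁻¹)(g_0 - V)`.
  rw [← sub_eq_zero, ← mul_sub, ← neg_eq_zero, ← mul_neg, ← h]
  congr 1
  rw [hξ, map_sub, Algebra.commutes, Algebra.commutes z]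
  noncomm_ring

end ShiftedProduct

/-! ### Parabolic spans and coefficient filtrations in a general Hecke algebra -/

section HeckeGeneral

variable {B W : Type*} [Group W] {M : CoxeterMatrix B} {cs : CoxeterSystem M W}

theorem closure_simple_induction {S : Set W} (hS : ∀ s ∈ S, ∃ i, s = cs.simple i)
    {P : (w : W) → w ∈ Subgroup.closure S → Prop} (h1 : P 1 (one_mem _))
    (hs : ∀ x i (hx : x ∈ Subgroup.closure S) (hi : cs.simple i ∈ S), P x hx →
      P (x * cs.simple i) (mul_mem hx (Subgroup.subset_closure hi)))
    {w : W} (hw : w ∈ Subgroup.closure S) : P w hw := by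
  induction hw using Subgroup.closure_induction_right with
  | one => exact h1
  | mul_right x hx y hy ih =>
    obtain ⟨i, rfl⟩ := hS y hy
    exact hs x i hx hy ih
  | mul_inv_cancel x hx y hy ih =>
    obtain ⟨i, rfl⟩ := hS y hy
    simp only [cs.inv_simple]
    exact hs x i hx hy ih

variable {Γ : Type*} [AddCommGroup Γ] [LinearOrder Γ] (L : WeightFunction cs Γ)

theorem T_mul_of_le {a b : W} (h : cs.length a + cs.length b ≤ cs.length (a * b)) :
    T L a * T L b = T L (a * b) :=
  T_mul L a b (le_antisymm (cs.length_mul_le a b) h)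

theorem T_mul_mul_of_le {a b c : W}
    (h : cs.length a + cs.length b + cs.length c ≤ cs.length (a * b * c)) :
    T L a * T L b * T L c = T L (a * b * c) := by
  have h1 := cs.length_mul_le (a * b) c
  have h2 := cs.length_mul_le a b
  rw [T_mul_of_le L (by omega), T_mul_of_le L (by omega)]

theorem TUnit_val (w : W) : ((TUnit L w : (Hecke L)ˣ) : Hecke L) = T L w := rfl

theorem TUnit_simple_inv (i : B) :
    (((TUnit L (cs.simple i))⁻¹ : (Hecke L)ˣ) : Hecke L) = Tsinv L i :=
  Units.inv_eq_of_mul_eq_one_right (T_simple_inv L i).1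

/-- This permits induction along arbitrary words of a parabolic subgroup: a property stable under
multiplication by both `T_s` and `T_s⁻¹` passes from `T_w` to `T_{ws}` whether the length goes up or
down. -/
theorem T_mul_simple (w : W) (i : B) :
    T L (w * cs.simple i) = T L w * T L (cs.simple i) ∨
      T L (w * cs.simple i) = T L w * Tsinv L i := by
  rcases cs.length_mul_simple w i with h | h
  · left
    rw [T_mul L _ _ (by rw [h, cs.length_simple])]
  · right
    have := T_mul L (w * cs.simple i) (cs.simple i) (by simp; omega)
    rw [cs.simple_mul_simple_cancel_right] at this
    rw [← this, mul_assoc, Tsinv, (T_simple_inv L i).1, mul_one]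

theorem mul_Tsinv (h : Hecke L) (i : B) :
    h * Tsinv L i = h * T L (cs.simple i) - xi L i • h := by
  rw [Tsinv, mul_sub, Algebra.smul_def, Algebra.commutes]

theorem bar_mul (h h' : Hecke L) : bar L (h * h') = bar L h * bar L h' := by
  induction h using hecke_induction L with
  | hadd h g e e' => rw [add_mul, bar_add, e, e', bar_add, add_mul]
  | hT a w =>
    rw [smul_mul_assoc, bar_smul, bar_smul, smul_mul_assoc]
    congr 1
    induction w using length_induction cs with
    | h1 => rw [bar_T_one, T_one, one_mul, one_mul]
    | hs i u hu ih =>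
      rw [bar_T_mul L hu, ← T_simple_mul_up L hu, mul_assoc, bar_T_simple_mul, ih, mul_assoc]

theorem bar_algebraMap (a : GroupRing Γ) :
    bar L (algebraMap (GroupRing Γ) (Hecke L) a) = algebraMap (GroupRing Γ) (Hecke L) (barA a) := by
  rw [Algebra.algebraMap_eq_smul_one, Algebra.algebraMap_eq_smul_one, ← T_one, bar_smul, bar_T_one,
    T_one]

/-- The span of the `T_w` with `w ∈ X`. -/
noncomputable def spanT (X : Set W) : Submodule (GroupRing Γ) (Hecke L) :=
  Submodule.span (GroupRing Γ) (T L '' X)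

variable {L}

theorem mem_spanT {X : Set W} {h : Hecke L} :
    h ∈ spanT L X ↔ ∀ y, (T L).repr h y ≠ 0 → y ∈ X := by
  rw [spanT, Module.Basis.mem_span_image]
  simp [Set.subset_def]

theorem T_mem_spanT {X : Set W} {w : W} (hw : w ∈ X) : T L w ∈ spanT L X :=
  Submodule.subset_span ⟨w, hw, rfl⟩

theorem spanT_mono {X Y : Set W} (h : X ⊆ Y) : spanT L X ≤ spanT L Y :=
  Submodule.span_mono (Set.image_mono h)

theorem mul_T_simple_mem_spanT {X : Set W} {i : B} (hX : ∀ w ∈ X, w * cs.simple i ∈ X)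
    {h : Hecke L} (hh : h ∈ spanT L X) : h * T L (cs.simple i) ∈ spanT L X := by
  induction hh using Submodule.span_induction with
  | mem x hx =>
    obtain ⟨w, hw, rfl⟩ := hx
    rcases T_mul_simple L w i with e | e
    · rw [← e]
      exact T_mem_spanT (hX w hw)
    · rw [mul_Tsinv, eq_sub_iff_add_eq] at e
      rw [← e]
      exact add_mem (T_mem_spanT (hX w hw)) (Submodule.smul_mem _ _ (T_mem_spanT hw))
  | zero => simp
  | add x y _ _ hx hy => rw [add_mul]; exact add_mem hx hy
  | smul a x _ hx => rw [smul_mul_assoc]; exact Submodule.smul_mem _ _ hx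

theorem mul_Tsinv_mem_spanT {X : Set W} {i : B} (hX : ∀ w ∈ X, w * cs.simple i ∈ X)
    {h : Hecke L} (hh : h ∈ spanT L X) : h * Tsinv L i ∈ spanT L X := by
  rw [mul_Tsinv]
  exact sub_mem (mul_T_simple_mem_spanT hX hh) (Submodule.smul_mem _ _ hh)

section Parabolic

variable {S : Set W}

theorem mul_mem_spanT (hS : ∀ s ∈ S, ∃ i, s = cs.simple i) {X : Set W}
    (hX : ∀ w ∈ X, ∀ s ∈ S, w * s ∈ X) {h x : Hecke L} (hh : h ∈ spanT L X)
    (hx : x ∈ spanT L (Subgroup.closure S : Set W)) : h * x ∈ spanT L X := by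
  induction hx using Submodule.span_induction with
  | mem x hx =>
    obtain ⟨u, hu, rfl⟩ := hx
    induction hu using closure_simple_induction hS with
    | h1 => rwa [T_one, mul_one]
    | hs u i _ hi ih =>
      rcases T_mul_simple L u i with e | e
      · rw [e, ← mul_assoc]
        exact mul_T_simple_mem_spanT (fun w hw => hX w hw _ hi) ih
      · rw [e, ← mul_assoc]
        exact mul_Tsinv_mem_spanT (fun w hw => hX w hw _ hi) ih
  | zero => simp
  | add x y _ _ hx hy => rw [mul_add]; exact add_mem hx hy
  | smul a x _ hx => rw [mul_smul_comm]; exact Submodule.smul_mem _ _ hx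

theorem bar_mem_spanT (hS : ∀ s ∈ S, ∃ i, s = cs.simple i) {x : Hecke L}
    (hx : x ∈ spanT L (Subgroup.closure S : Set W)) :
    bar L x ∈ spanT L (Subgroup.closure S : Set W) := by
  induction hx using Submodule.span_induction with
  | mem x hx =>
    obtain ⟨u, hu, rfl⟩ := hx
    induction hu using closure_simple_induction hS with
    | h1 => rw [bar_T_one, ← T_one]; exact T_mem_spanT (one_mem _)
    | hs u i _ hi ih =>
      have hX : ∀ w ∈ (Subgroup.closure S : Set W), w * cs.simple i ∈
        (Subgroup.closure S : Set W) := fun w hw => mul_mem hw (Subgroup.subset_closure hi)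
      have e1 : bar L (T L (cs.simple i)) = Tsinv L i := by
        rw [bar_T, cs.inv_simple, TUnit_simple_inv]
      have e2 : bar L (Tsinv L i) = T L (cs.simple i) := by rw [← e1, bar_bar]
      rcases T_mul_simple L u i with e | e
      · rw [e, bar_mul, e1]
        exact mul_Tsinv_mem_spanT hX ih
      · rw [e, bar_mul, e2]
        exact mul_T_simple_mem_spanT hX ih
  | zero => rw [bar_zero]; exact zero_mem _
  | add x y _ _ hx hy => rw [bar_add]; exact add_mem hx hy
  | smul a x _ hx => rw [bar_smul]; exact Submodule.smul_mem _ _ hx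

theorem commute_T_of_mem_closure (hS : ∀ s ∈ S, ∃ i, s = cs.simple i) {h : Hecke L}
    (hh : ∀ i, cs.simple i ∈ S → Commute h (T L (cs.simple i))) {u : W}
    (hu : u ∈ Subgroup.closure S) : Commute h (T L u) := by
  induction hu using closure_simple_induction hS with
  | h1 => rw [T_one]; exact Commute.one_right _
  | hs u i _ hi ih =>
    rcases T_mul_simple L u i with e | e
    · rw [e]
      exact ih.mul_right (hh i hi)
    · rw [e]
      exact ih.mul_right ((hh i hi).sub_right (Algebra.commutes _ _).symm)

variable [IsOrderedAddMonoid Γ]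

theorem KLelt_spec (L : WeightFunction cs Γ) (w : W) : IsKL L w (KLelt L w) :=
  (existsUnique_isKL L w).choose_spec.1

theorem eq_KLelt {w : W} {C : Hecke L} (h : IsKL L w C) : C = KLelt L w :=
  (existsUnique_isKL L w).unique h (KLelt_spec L w)

/-- Let `g` be the part of `C` supported on the parabolic subgroup `H`. Since the span of the `T_w`
with `w ∈ H` is bar-stable, `C - g` is bar-invariant modulo it. Its coefficients off `H` are
negative, so a top-length one is both negative and bar-invariant, hence zero; descending induction
on the length gives `C = g`. -/
theorem KLelt_mem_spanT (hS : ∀ s ∈ S, ∃ i, s = cs.simple i) {w : W}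
    (hw : w ∈ Subgroup.closure S) : KLelt L w ∈ spanT L (Subgroup.closure S : Set W) := by
  classical
  obtain ⟨hb, hn⟩ := KLelt_spec L w
  set C := KLelt L w with hC
  let g : Hecke L := (T L).repr.symm (((T L).repr C).filter (· ∈ Subgroup.closure S))
  have hg : ∀ y, (T L).repr g y = if y ∈ Subgroup.closure S then (T L).repr C y else 0 := by
    intro y
    simp only [g, LinearEquiv.apply_symm_apply]
    exact Finsupp.filter_apply _ _ _
  have hgm : g ∈ spanT L (Subgroup.closure S : Set W) := by
    rw [mem_spanT]
    intro y hy
    by_contra h0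
    exact hy (by rw [hg]; exact if_neg h0)
  have hr : ∀ y, (T L).repr (C - g) y = if y ∈ Subgroup.closure S then 0 else (T L).repr C y := by
    intro y
    rw [map_sub, Finsupp.sub_apply, hg]
    split_ifs <;> simp
  have hneg : ∀ y, y ∉ Subgroup.closure S → IsNegative ((T L).repr (C - g) y) := by
    intro y hy
    have := hn y
    rw [hr, if_neg hy]
    rwa [map_sub, Finsupp.sub_apply, Module.Basis.repr_self, Finsupp.single_apply,
      if_neg (by rintro rfl; exact hy hw), sub_zero] at this
  have hbar : bar L (C - g) - (C - g) ∈ spanT L (Subgroup.closure S : Set W) := by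
    rw [bar_sub, hb]
    have : C - bar L g - (C - g) = g - bar L g := by abel
    rw [this]
    exact sub_mem hgm (bar_mem_spanT hS hgm)
  have h0 : C - g = 0 := by
    obtain ⟨k, hk⟩ := exists_mem_Fil L (C - g)
    induction k with
    | zero => exact eq_zero_of_mem_Fil_zero L hk
    | succ k ih =>
      refine ih (mem_Fil_of_top L hk fun y hy => ?_)
      by_cases hyS : y ∈ Subgroup.closure S
      · rw [hr, if_pos hyS]
      · refine eq_zero_of_isNegative (hneg y hyS) ?_
        -- At a top length the bar acts on coefficients by `barA`, and off `H` the coefficients of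
        -- `bar (C - g)` and `C - g` agree by `hbar`.
        rw [← repr_bar L hk y hy, ← sub_eq_zero, ← Finsupp.sub_apply, ← map_sub]
        by_contra h
        exact hyS (mem_spanT.mp hbar y h)
  rw [sub_eq_zero.mp h0]
  exact hgm

end Parabolic

section Coefficients

variable (L) in
/-- The elements of the Hecke algebra all of whose coefficients lie in `P`. -/
noncomputable def coeffsIn (P : AddSubgroup (GroupRing Γ)) : AddSubgroup (Hecke L) where
  carrier := {h | ∀ y, (T L).repr h y ∈ P}
  zero_mem' y := by simp
  add_mem' ha hb y := by
    rw [map_add]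
    exact add_mem (ha y) (hb y)
  neg_mem' ha y := by
    rw [map_neg]
    exact neg_mem (ha y)

theorem smul_T_mem_coeffsIn {P : AddSubgroup (GroupRing Γ)} {a : GroupRing Γ} (ha : a ∈ P) (w : W) :
    a • T L w ∈ coeffsIn L P := by
  classical
  intro y
  rw [map_smul, Module.Basis.repr_self, Finsupp.smul_single, smul_eq_mul, mul_one,
    Finsupp.single_apply]
  split_ifs
  · exact ha
  · exact zero_mem _

theorem smul_mem_coeffsIn {P Q : AddSubgroup (GroupRing Γ)} {a : GroupRing Γ}
    (ha : ∀ b ∈ P, a * b ∈ Q) {h : Hecke L} (hh : h ∈ coeffsIn L P) : a • h ∈ coeffsIn L Q := by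
  intro y
  rw [map_smul, Finsupp.smul_apply, smul_eq_mul]
  exact ha _ (hh y)

/-- Restricting the hypothesis to nonzero coefficients makes support information about `h` available
when the products `T_w x` are evaluated. -/
theorem mul_mem_of_forall_T_mul {P : AddSubgroup (Hecke L)} {h x : Hecke L}
    (hP : ∀ w, (T L).repr h w ≠ 0 → (T L).repr h w • (T L w * x) ∈ P) : h * x ∈ P := by
  rw [← (T L).linearCombination_repr h, Finsupp.linearCombination_apply, Finsupp.sum,
    Finset.sum_mul]
  refine sum_mem fun w hw => ?_
  rw [smul_mul_assoc]
  exact hP w (Finsupp.mem_support_iff.mp hw)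

theorem mul_mem_of_forall_mul_T {P : AddSubgroup (Hecke L)} {h x : Hecke L}
    (hP : ∀ w, (T L).repr x w ≠ 0 → (T L).repr x w • (h * T L w) ∈ P) : h * x ∈ P := by
  rw [← (T L).linearCombination_repr x, Finsupp.linearCombination_apply, Finsupp.sum,
    Finset.mul_sum]
  refine sum_mem fun w hw => ?_
  rw [mul_smul_comm]
  exact hP w (Finsupp.mem_support_iff.mp hw)

theorem mul_T_simple_mem_coeffsIn {P : AddSubgroup (GroupRing Γ)} {i : B}
    (hP : ∀ b ∈ P, xi L i * b ∈ P) {h : Hecke L} (hh : h ∈ coeffsIn L P) :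
    h * T L (cs.simple i) ∈ coeffsIn L P := by
  refine mul_mem_of_forall_T_mul fun w _ => ?_
  rcases T_mul_simple L w i with e | e
  · rw [← e]
    exact smul_T_mem_coeffsIn (hh w) _
  · rw [mul_Tsinv, eq_sub_iff_add_eq] at e
    rw [← e, smul_add, smul_smul, mul_comm]
    exact add_mem (smul_T_mem_coeffsIn (hh w) _) (smul_T_mem_coeffsIn (hP _ (hh w)) _)

theorem mul_Tsinv_mem_coeffsIn {P : AddSubgroup (GroupRing Γ)} {i : B}
    (hP : ∀ b ∈ P, xi L i * b ∈ P) {h : Hecke L} (hh : h ∈ coeffsIn L P) :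
    h * Tsinv L i ∈ coeffsIn L P := by
  rw [mul_Tsinv]
  exact sub_mem (mul_T_simple_mem_coeffsIn hP hh) (smul_mem_coeffsIn hP hh)

theorem mul_T_mem_coeffsIn {S : Set W} (hS : ∀ s ∈ S, ∃ i, s = cs.simple i)
    {P : AddSubgroup (GroupRing Γ)} (hP : ∀ i, cs.simple i ∈ S → ∀ b ∈ P, xi L i * b ∈ P)
    {h : Hecke L} (hh : h ∈ coeffsIn L P) {u : W} (hu : u ∈ Subgroup.closure S) :
    h * T L u ∈ coeffsIn L P := by
  induction hu using closure_simple_induction hS with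
  | h1 => rwa [T_one, mul_one]
  | hs u i _ hi ih =>
    rcases T_mul_simple L u i with e | e
    · rw [e, ← mul_assoc]
      exact mul_T_simple_mem_coeffsIn (hP i hi) ih
    · rw [e, ← mul_assoc]
      exact mul_Tsinv_mem_coeffsIn (hP i hi) ih

/-- The subgroup `A_{< 0}` of `A`. -/
def negativePart (Γ : Type*) [AddCommGroup Γ] [LinearOrder Γ] : AddSubgroup (GroupRing Γ) where
  carrier := {a | IsNegative a}
  zero_mem' γ h := absurd (coeffAt_zero γ) h
  add_mem' ha hb := isNegative_add ha hb
  neg_mem' {a} ha γ h := ha γ (by rwa [coeffAt_neg, neg_ne_zero] at h)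

theorem isKL_iff {w : W} {C : Hecke L} :
    IsKL L w C ↔ bar L C = C ∧ C - T L w ∈ coeffsIn L (negativePart Γ) := Iff.rfl

end Coefficients

end HeckeGeneral

/-! ### Multiplication in the group ring -/

section GroupRingMul

variable {Γ : Type*} [AddCommGroup Γ]

theorem vpow_mul (γ δ : Γ) : vpow γ * vpow δ = vpow (γ + δ) :=
  (AddMonoidAlgebra.single_mul_single γ δ (1 : ℤ) 1).trans (by rw [mul_one]; rfl)

open Classical in
theorem coeffAt_vpow {Γ : Type*} (γ δ : Γ) : (vpow γ).coeffAt δ = if γ = δ then 1 else 0 :=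
  Finsupp.single_apply

theorem exists_of_coeffAt_mul_ne_zero {a b : GroupRing Γ} {γ : Γ} (h : (a * b).coeffAt γ ≠ 0) :
    ∃ α β, a.coeffAt α ≠ 0 ∧ b.coeffAt β ≠ 0 ∧ α + β = γ := by
  classical
  by_contra! h0
  refine h ((AddMonoidAlgebra.coeff_mul (R := ℤ) a b γ).trans ?_)
  refine Finset.sum_eq_zero fun α hα => Finset.sum_eq_zero fun β hβ => ?_
  exact if_neg (h0 α β (Finsupp.mem_support_iff.mp hα) (Finsupp.mem_support_iff.mp hβ))

end GroupRingMul

/-! ### Filtration of `A` by the degree in `V` -/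

section DegreeFiltration

/-- The elements of `A` of degree at most `k` in `V`. -/
def vDegLE (k : ℤ) : AddSubgroup (GroupRing (ℤ ×ₗ ℤ)) where
  carrier := {a | ∀ γ, a.coeffAt γ ≠ 0 → (ofLex γ).1 ≤ k}
  zero_mem' γ h := absurd (coeffAt_zero γ) h
  add_mem' {a b} ha hb γ h := by
    by_contra h0
    have h1 : a.coeffAt γ = 0 := by by_contra h; exact h0 (ha γ h)
    have h2 : b.coeffAt γ = 0 := by by_contra h; exact h0 (hb γ h)
    exact h (by rw [coeffAt_add, h1, h2, add_zero])
  neg_mem' {a} ha γ h := ha γ (by rwa [coeffAt_neg, neg_ne_zero] at h)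

theorem mul_mem_vDegLE {k m r : ℤ} {a b : GroupRing (ℤ ×ₗ ℤ)} (ha : a ∈ vDegLE k)
    (hb : b ∈ vDegLE m) (h : k + m ≤ r) : a * b ∈ vDegLE r := by
  intro γ hγ
  obtain ⟨α, β, h1, h2, rfl⟩ := exists_of_coeffAt_mul_ne_zero hγ
  have e1 := ha α h1
  have e2 := hb β h2
  rw [ofLex_add, Prod.fst_add]
  omega

theorem vpow_mem_vDegLE {γ : ℤ ×ₗ ℤ} {k : ℤ} (h : (ofLex γ).1 ≤ k) : vpow γ ∈ vDegLE k := by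
  intro δ hδ
  rw [coeffAt_vpow] at hδ
  by_cases e : γ = δ
  · rwa [← e]
  · rw [if_neg e] at hδ
    exact absurd rfl hδ

theorem vDegLE_mono {k m : ℤ} (h : k ≤ m) : vDegLE k ≤ vDegLE m :=
  fun _ ha γ hγ => (ha γ hγ).trans h

/-- The first coordinate decides in the lexicographic order. Unlike `A_{<0}`, the subgroup of
`V`-degree at most -1 is stable under multiplication by everything of `V`-degree 0. -/
theorem vDegLE_neg_one_le : vDegLE (-1) ≤ negativePart (ℤ ×ₗ ℤ) := by
  intro a ha γ hγ
  have := ha γ hγ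
  rw [Prod.Lex.lt_iff]
  left
  change (ofLex γ).1 < 0
  omega

theorem negativePart_le_vDegLE : negativePart (ℤ ×ₗ ℤ) ≤ vDegLE 0 := by
  intro a ha γ hγ
  have := ha γ hγ
  rw [Prod.Lex.lt_iff] at this
  change (ofLex γ).1 < 0 ∨ (ofLex γ).1 = 0 ∧ _ at this
  rcases this with h | h
  · exact h.le
  · exact h.1.le

theorem Vpow_mul (k m : ℤ) : Vpow k * Vpow m = Vpow (k + m) := by
  rw [Vpow, Vpow, vpow_mul, ← toLex_add, Prod.mk_add_mk, add_zero, Vpow]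

theorem Vpow_zero : Vpow 0 = 1 := rfl

theorem barA_Vpow (k : ℤ) : barA (Vpow k) = Vpow (-k) := by
  rw [Vpow, barA_vpow, ← toLex_neg, Prod.neg_mk, neg_zero, Vpow]

/-- For `k ≥ 1` the first coordinate of `L(s_k)` is 0, so multiplying by these generators and their
inverses does not raise the degree in `V`. -/
theorem xi_LB_mul_mem {n : ℕ} {i : Fin n} (hi : 1 ≤ i.val) {k : ℤ} :
    ∀ b ∈ vDegLE k, xi (LB n) i * b ∈ vDegLE k := by
  intro b hb
  have h : (ofLex ((LB n).toFun ((csB n).simple i))).1 = 0 := by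
    change (ellT n ((csB n).simple i) : ℤ) = 0
    rw [ellT_simple, if_neg (by omega), Nat.cast_zero]
  refine mul_mem_vDegLE (sub_mem (vpow_mem_vDegLE (k := 0) h.le)
    (vpow_mem_vDegLE (k := 0) ?_)) hb (by omega)
  rw [ofLex_neg, Prod.fst_neg, h, neg_zero]

theorem xi_LB_zero {n : ℕ} (hn : 0 < n) : xi (LB n) ⟨0, hn⟩ = Vpow 1 - Vpow (-1) := by
  have h : (LB n).toFun ((csB n).simple ⟨0, hn⟩) = toLex (1, 0) := by
    change toLex ((ellT n ((csB n).simple ⟨0, hn⟩) : ℤ), ellS n _) = _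
    rw [ellS, ellT_simple, (csB n).length_simple]
    simp
  rw [xi, h, Vpow, Vpow, ← toLex_neg, Prod.neg_mk, neg_zero]

end DegreeFiltration

/-! ### The Hecke algebra of type `B_n`: commutation, recursion and bar-invariance of `P_l
T_{σ_l}⁻¹` -/

section HeckeB

theorem symB_generators (n l : ℕ) : ∀ s ∈ {w : WB n | ∃ k : Fin n, 1 ≤ k.val ∧ k.val < l ∧
    w = (csB n).simple k}, ∃ i, s = (csB n).simple i := fun _ ⟨k, _, _, h⟩ => ⟨k, h⟩

theorem parB_generators (n l : ℕ) : ∀ s ∈ {w : WB n | ∃ k : Fin n, k.val < l ∧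
    w = (csB n).simple k}, ∃ i, s = (csB n).simple i := fun _ ⟨k, _, h⟩ => ⟨k, h⟩

/-- Needed to read off the index of a generator from its membership in the generating set of `𝔖_n`.
-/
theorem simple_injective_B (n : ℕ) : Function.Injective (csB n).simple := by
  have key : ∀ i j : Fin n, i < j → (csB n).simple i ≠ (csB n).simple j := by
    intro i j hij h
    have h1 := congrArg (fun w => signedAction n w (j + 1)) h
    simp only [signedAction_simple] at h1
    rw [signedStep_fix (by omega), signedStep_down (by omega) rfl] at h1
    omega
  intro i j h
  rcases lt_trichotomy i j with h1 | h1 | h1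
  · exact absurd h (key i j h1)
  · exact h1
  · exact absurd h.symm (key j i h1)

theorem mul_mem_spanT_symB {n l : ℕ} {X : Set (WB n)}
    (hX : ∀ w ∈ X, ∀ u ∈ symB n l, w * u ∈ X) {h x : HB n} (hh : h ∈ spanT (LB n) X)
    (hx : x ∈ spanT (LB n) (symB n l : Set (WB n))) : h * x ∈ spanT (LB n) X :=
  mul_mem_spanT (symB_generators n l) (fun w hw s hs => hX w hw s (Subgroup.subset_closure hs)) hh
    hx

theorem mul_mem_spanT_parB {n l : ℕ} {h x : HB n}
    (hh : h ∈ spanT (LB n) (parB n l : Set (WB n)))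
    (hx : x ∈ spanT (LB n) (parB n l : Set (WB n))) :
    h * x ∈ spanT (LB n) (parB n l : Set (WB n)) :=
  mul_mem_spanT (parB_generators n l)
    (fun _ hw _ hs => mul_mem hw (Subgroup.subset_closure hs)) hh hx

/-- The generators `T_{s_k}` (with `s_0 = t`) of the Hecke algebra as units. -/
noncomputable def genUnit (n k : ℕ) : (HB n)ˣ := TUnit (LB n) (sB n k)

theorem genUnit_val (n k : ℕ) : (genUnit n k : HB n) = T (LB n) (sB n k) := rfl

theorem length_sB {n k : ℕ} (hk : k < n) : (csB n).length (sB n k) = 1 := by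
  rw [sB, dif_pos hk, (csB n).length_simple]

theorem sB_comm_of_lt {n i k : ℕ} (h : i + 2 ≤ k) (hk : k < n) :
    sB n i * sB n k = sB n k * sB n i := by
  have h1 := (csB n).simple_mul_simple_pow ⟨i, by omega⟩ ⟨k, hk⟩
  rw [matB_apply, if_neg (by simp; omega), if_neg (by simp; omega), if_neg (by simp; omega)] at h1
  rw [sB, dif_pos (by omega : i < n), sB, dif_pos hk]
  rw [pow_two, mul_eq_one_iff_eq_inv, mul_inv_rev, (csB n).inv_simple, (csB n).inv_simple] at h1
  exact h1

theorem sB_braid_zero {n : ℕ} (hn : 1 < n) :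
    sB n 0 * sB n 1 * sB n 0 * sB n 1 = sB n 1 * sB n 0 * sB n 1 * sB n 0 := by
  have h1 := (csB n).simple_mul_simple_pow ⟨0, by omega⟩ ⟨1, hn⟩
  rw [matB_apply, if_neg (by simp), if_pos (by simp)] at h1
  rw [sB, dif_pos (by omega : 0 < n), sB, dif_pos hn]
  have h2 : (csB n).simple ⟨0, by omega⟩ * (csB n).simple ⟨1, hn⟩ *
      (csB n).simple ⟨0, by omega⟩ * (csB n).simple ⟨1, hn⟩ *
      ((csB n).simple ⟨0, by omega⟩ * (csB n).simple ⟨1, hn⟩ *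
      (csB n).simple ⟨0, by omega⟩ * (csB n).simple ⟨1, hn⟩) = 1 := by
    rw [← h1]
    simp only [pow_succ, pow_zero, one_mul, mul_assoc]
  rw [mul_eq_one_iff_eq_inv] at h2
  rw [h2]
  simp [mul_assoc]

theorem length_sB_mul_sB {n i k : ℕ} (h : i < k) (hk : k < n) :
    (csB n).length (sB n i * sB n k) = 2 := by
  have := length_mul_cosetB hk (j := 1) (by omega) (sB_mem_parB h (by omega) : sB n i ∈ parB n k)
  rw [length_sB (by omega)] at this
  simpa [cosetB] using this

/-- Both sides of each relation are `T` of the same group element, because the two words are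
reduced; their lengths come from `length_mul_cosetB` and, for the relation of order 4, from `t s_1 t
s_1 = t t_2` and `length_mul_tB`. -/
theorem genUnit_braidRelations (n : ℕ) : BraidRelations n (genUnit n) where
  comm i k h hk := by
    apply Units.ext
    have h1 := length_sB_mul_sB (n := n) (i := i) (k := k) (by omega) hk
    rw [Units.val_mul, Units.val_mul, genUnit_val, genUnit_val, T_mul, sB_comm_of_lt h hk, T_mul]
    · rw [← sB_comm_of_lt h hk, h1, length_sB hk, length_sB (by omega)]
    · rw [h1, length_sB hk, length_sB (by omega)]
  braid i hi hk := by
    apply Units.ext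
    have e : sB n i * cosetB n (i + 1) 2 = sB n i * sB n (i + 1) * sB n i := by
      simp [cosetB, mul_assoc]
    have h1 := length_mul_cosetB hk (j := 2) (by omega)
      (sB_mem_parB (by omega) (by omega) : sB n i ∈ parB n (i + 1))
    rw [e] at h1
    simp only [Units.val_mul, genUnit_val]
    rw [T_mul_mul_of_le, T_mul_mul_of_le, sB_braid n i hi hk]
    · rw [h1, length_sB hk, length_sB (by omega)]
    · rw [sB_braid n i hi hk, h1, length_sB hk, length_sB (by omega)]
  braid_zero hn := by
    apply Units.ext
    have ht : sB n 1 * sB n 0 * sB n 1 = tB n 2 := rfl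
    have l0 : (csB n).length (sB n 0) = 1 := length_sB (by omega)
    have l1 : (csB n).length (sB n 1) = 1 := length_sB hn
    have l2 : (csB n).length (tB n 2) = 3 := length_tB hn
    have l3 : (csB n).length (sB n 0 * tB n 2) = 4 := by
      rw [length_mul_tB hn (sB_mem_parB (by omega) (by omega)), l0]
    have e1 : sB n 0 * sB n 1 * sB n 0 * sB n 1 = sB n 0 * tB n 2 := by
      rw [← ht]; simp only [mul_assoc]
    have e2 : tB n 2 * sB n 0 = sB n 0 * tB n 2 := by
      rw [← e1, sB_braid_zero hn, ht]
    have hT : T (LB n) (sB n 1) * T (LB n) (sB n 0) * T (LB n) (sB n 1) = T (LB n) (tB n 2) := by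
      rw [T_mul_mul_of_le, ht]
      rw [ht, l2, l0, l1]
    have : T (LB n) (sB n 0) * T (LB n) (sB n 1) * T (LB n) (sB n 0) * T (LB n) (sB n 1) =
        T (LB n) (sB n 0) * T (LB n) (tB n 2) := by
      rw [← hT]; simp only [mul_assoc]
    simp only [Units.val_mul, genUnit_val]
    rw [this, hT, T_mul, T_mul, e2]
    · rw [e2, l3, l2, l0]
    · rw [l3, l2, l0]

/-- The parameters `v ^ L(s_k) - v ^ (-L(s_k))`. -/
noncomputable def xiB (n k : ℕ) : GroupRing (ℤ ×ₗ ℤ) :=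
  if h : k < n then xi (LB n) ⟨k, h⟩ else 0

theorem genUnit_mul_self (n : ℕ) : ∀ i < n, (genUnit n i : HB n) * genUnit n i =
    1 + algebraMap (GroupRing (ℤ ×ₗ ℤ)) (HB n) (xiB n i) * genUnit n i := by
  intro i hi
  rw [genUnit_val, xiB, dif_pos hi, sB, dif_pos hi, T_simple_sq, Algebra.smul_def]

/-- The palindromic word for `t_{l+1}` is reduced, of length `2l + 1`, so `T` is multiplicative
along it. -/
theorem T_tB {n l : ℕ} (hl : l < n) :
    T (LB n) (tB n (l + 1)) = (jucysMurphy (genUnit n) (l + 1) : (HB n)ˣ) := by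
  induction l with
  | zero => rfl
  | succ l ih =>
    have h1 := length_tB hl
    have h2 := length_tB (show l < n by omega)
    have h3 := length_sB hl
    rw [jucysMurphy, Units.val_mul, Units.val_mul, ← ih (by omega), genUnit_val, T_mul_mul_of_le]
    · rfl
    · change _ ≤ (csB n).length (tB n (l + 1 + 1))
      omega

theorem PB_eq {n l : ℕ} (hl : l ≤ n) : PB n l = shiftedProd (genUnit n) (Vpow (-1)) l := by
  rw [PB, shiftedProd]
  congr 1
  refine List.map_congr_left fun i hi => ?_
  rw [List.mem_range] at hi
  rw [T_tB (by omega)]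

theorem T_cosetB {n l : ℕ} (hl : l < n) :
    T (LB n) (cosetB n l l) = (descProd (genUnit n) l : (HB n)ˣ) := by
  induction l with
  | zero => rw [cosetB, T_one]; rfl
  | succ l ih =>
    rw [descProd, Units.val_mul, ← ih (by omega), genUnit_val, T_mul, cosetB_succ]
    rw [← cosetB_succ, length_cosetB hl le_rfl, length_cosetB (by omega) le_rfl, length_sB hl,
      add_comm]

theorem T_rB {n l : ℕ} (hl : l < n) :
    T (LB n) (rB n (l + 1)) = (descProd (genUnit n) l : (HB n)ˣ) * T (LB n) (sB n 0) := by
  induction l with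
  | zero => simp [descProd, rB]
  | succ l ih =>
    rw [descProd, Units.val_mul, mul_assoc, ← ih (by omega), genUnit_val, T_mul, rB]
    change (csB n).length (rB n (l + 1 + 1)) = _
    rw [length_rB hl, length_rB (by omega), length_sB hl, add_comm]

/-- The inverses cancel the right half `g_1 ⋯ g_l` of the palindrome. -/
theorem jucysMurphy_mul_descProd_inv {G : Type*} [Group G] (g : ℕ → G) (l : ℕ) :
    jucysMurphy g (l + 1) * descProd (fun i => (g i)⁻¹) l = descProd g l * g 0 := by
  induction l with
  | zero => simp [jucysMurphy, descProd]
  | succ l ih =>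
    rw [jucysMurphy, descProd, descProd, mul_assoc (g (l + 1)) (descProd g l), ← ih]
    simp [mul_assoc]

theorem bar_genUnit {n k : ℕ} (hk : k < n) :
    bar (LB n) (genUnit n k : HB n) = ((genUnit n k)⁻¹ : (HB n)ˣ) := by
  rw [genUnit_val, genUnit, sB, dif_pos hk, bar_T, (csB n).inv_simple]

theorem bar_descProd {n l : ℕ} (hl : l < n) :
    bar (LB n) (descProd (genUnit n) l : (HB n)ˣ) =
      (descProd (fun i => (genUnit n i)⁻¹) l : (HB n)ˣ) := by
  induction l with
  | zero => exact (congrArg _ (T_one _).symm).trans (bar_T_one _)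
  | succ l ih =>
    rw [descProd, descProd, Units.val_mul, Units.val_mul, bar_mul, ih (by omega), bar_genUnit hl]

theorem commute_T_symB {n l : ℕ} {h : HB n}
    (hh : ∀ k, 1 ≤ k → k < l → k < n → Commute h (genUnit n k : HB n)) {u : WB n}
    (hu : u ∈ symB n l) : Commute h (T (LB n) u) := by
  refine commute_T_of_mem_closure (symB_generators n l) ?_ hu
  rintro i ⟨k, h1, h2, h3⟩
  have := hh k h1 h2 k.isLt
  rwa [genUnit_val, sB, dif_pos k.isLt, ← h3] at this

theorem commute_PB_TinvB {n l : ℕ} (hl : l ≤ n) :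
    Commute (PB n l) (TinvB n (sigmaB n l)) := by
  refine Commute.units_inv_right (u := TUnit (LB n) (sigmaB n l)) ?_
  refine commute_T_symB (fun k h1 h2 _ => ?_) (sigmaB_spec n l).1
  rw [PB_eq hl]
  exact ((genUnit_braidRelations n).commute_shiftedProd (genUnit_mul_self n) _ h1 h2 hl).symm

theorem TinvB_sigmaB_zero (n : ℕ) : TinvB n (sigmaB n 0) = 1 := by
  have h : sigmaB n 0 = 1 := by simpa [symB] using (sigmaB_spec n 0).1
  rw [TinvB, h]
  have : TUnit (LB n) 1 = 1 := Units.ext (T_one _)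
  rw [this, inv_one, Units.val_one]

/-- As `σ_{l+1}` and `σ_l` are involutions, `σ_{l+1} = c⁻¹ σ_l` with `c = s_l ⋯ s_1` and lengths
adding; moreover `T_{c⁻¹}⁻¹` is the bar of `T_c = g_l ⋯ g_1`. -/
theorem TinvB_sigmaB_succ {n l : ℕ} (hl : l < n) : TinvB n (sigmaB n (l + 1)) =
    TinvB n (sigmaB n l) * (descProd (fun i => (genUnit n i)⁻¹) l : (HB n)ˣ) := by
  have e1 : sigmaB n (l + 1) = (cosetB n l l)⁻¹ * sigmaB n l := by
    rw [← sigmaB_inv (l := l + 1) hl, sigmaB_succ hl, mul_inv_rev, sigmaB_inv hl.le]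
  have e2 : TUnit (LB n) (sigmaB n (l + 1)) =
      TUnit (LB n) (cosetB n l l)⁻¹ * TUnit (LB n) (sigmaB n l) := by
    apply Units.ext
    rw [Units.val_mul, TUnit_val, TUnit_val, TUnit_val, e1, T_mul]
    rw [← e1, ← sigmaB_inv (l := l + 1) hl, (csB n).length_inv, (csB n).length_inv, sigmaB_succ hl,
      length_mul_cosetB hl le_rfl (symB_le_parB n l (sigmaB_spec n l).1),
      length_cosetB hl le_rfl, add_comm]
  rw [TinvB, TinvB, e2, mul_inv_rev, Units.val_mul, ← bar_T, T_cosetB hl, bar_descProd hl]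

theorem PB_succ (n l : ℕ) : PB n (l + 1) = PB n l * (T (LB n) (tB n (l + 1)) +
    algebraMap (GroupRing (ℤ ×ₗ ℤ)) (HB n) (Vpow (-1))) := by
  simp [PB, List.range_succ]

theorem T_tB_mul {n l : ℕ} (hl : l < n) : T (LB n) (tB n (l + 1)) *
    (descProd (fun i => (genUnit n i)⁻¹) l : (HB n)ˣ) = T (LB n) (rB n (l + 1)) := by
  rw [T_tB hl, ← Units.val_mul, jucysMurphy_mul_descProd_inv, Units.val_mul, T_rB hl, genUnit_val]

/-- The last factor of `P_{l+1}` commutes with `T_{σ_l}⁻¹`, since `J_{l+1}` commutes with `g_1, …,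
g_{l-1}`; it then absorbs `g_l⁻¹ ⋯ g_1⁻¹`, turning `T_{t_{l+1}}` into `T_{r_{l+1}}`. -/
theorem PB_mul_TinvB_succ {n l : ℕ} (hl : l < n) :
    PB n (l + 1) * TinvB n (sigmaB n (l + 1)) = PB n l * TinvB n (sigmaB n l) *
      (T (LB n) (rB n (l + 1)) + algebraMap (GroupRing (ℤ ×ₗ ℤ)) (HB n) (Vpow (-1)) *
        (descProd (fun i => (genUnit n i)⁻¹) l : (HB n)ˣ)) := by
  have hc : Commute (T (LB n) (tB n (l + 1)) + algebraMap (GroupRing (ℤ ×ₗ ℤ)) (HB n) (Vpow (-1)))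
      (TinvB n (sigmaB n l)) := by
    refine Commute.add_left ?_ (Algebra.commutes _ _)
    refine Commute.units_inv_right (u := TUnit (LB n) (sigmaB n l)) ?_
    refine commute_T_symB (fun k _ h2 _ => ?_) (sigmaB_spec n l).1
    rw [T_tB hl]
    exact ((genUnit_braidRelations n).commute_jucysMurphy h2 hl).symm.units_val
  rw [PB_succ, TinvB_sigmaB_succ hl, mul_assoc (PB n l), ← mul_assoc _ (TinvB n (sigmaB n l)),
    hc.eq, mul_assoc (TinvB n (sigmaB n l)), add_mul, T_tB_mul hl, mul_assoc]

theorem bar_PB_mul_TinvB {n l : ℕ} (hl : l ≤ n) :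
    bar (LB n) (PB n l * TinvB n (sigmaB n l)) = PB n l * TinvB n (sigmaB n l) := by
  induction l with
  | zero =>
    rw [TinvB_sigmaB_zero, mul_one]
    exact (congrArg _ (T_one _).symm).trans (bar_T_one _)
  | succ l ih =>
    have hn : 0 < n := by omega
    have hx : xiB n 0 = Vpow 1 - Vpow (-1) := by rw [xiB, dif_pos hn, xi_LB_zero]
    have key := (genUnit_braidRelations n).shiftedProd_mul_eq (genUnit_mul_self n)
      (z := Vpow (-1)) (V := Vpow 1) (by rw [Vpow_mul]; rfl) hx (l := l) (by omega)
    have hb0 : bar (LB n) (T (LB n) (sB n 0)) =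
        (genUnit n 0 : HB n) - algebraMap (GroupRing (ℤ ×ₗ ℤ)) (HB n) (xiB n 0) := by
      rw [genUnit_val, sB, dif_pos hn, bar_T, (csB n).inv_simple, TUnit_simple_inv, Tsinv, xiB,
        dif_pos hn]
    -- After the induction hypothesis, `P_l` and `T_{σ_l}⁻¹` are exchanged so that `P_l` stands next
    -- to the new factor and `key` applies.
    rw [PB_mul_TinvB_succ hl, bar_mul, ih (by omega), bar_add, T_rB hl, bar_mul, bar_mul,
      bar_descProd hl, hb0, bar_algebraMap, barA_Vpow, neg_neg, ← bar_descProd hl, bar_bar,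
      bar_descProd hl, (commute_PB_TinvB (by omega)).eq, mul_assoc, mul_assoc,
      PB_eq (by omega), key, genUnit_val]

end HeckeB

/-! ### Triangularity, and multiplicativity of `C_{a_l} C_σ` -/

section Triangularity

theorem coeffsIn_mono {n : ℕ} {P Q : AddSubgroup (GroupRing (ℤ ×ₗ ℤ))} (h : P ≤ Q) :
    coeffsIn (LB n) P ≤ coeffsIn (LB n) Q := fun _ hx y => h (hx y)

theorem tB_mem_parB {n l i : ℕ} (hi : i < l) (hl : l ≤ n) : tB n (i + 1) ∈ parB n l := by
  induction i with
  | zero => exact sB_mem_parB hi (by omega)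
  | succ i ih =>
    have h : sB n (i + 1) ∈ parB n l := sB_mem_parB hi (by omega)
    exact mul_mem (mul_mem h (ih (by omega))) h

theorem PB_mem_spanT {n l : ℕ} (hl : l ≤ n) :
    PB n l ∈ spanT (LB n) (parB n l : Set (WB n)) := by
  have key : ∀ m ≤ l, PB n m ∈ spanT (LB n) (parB n l : Set (WB n)) := by
    intro m
    induction m with
    | zero =>
      intro _
      change (1 : HB n) ∈ _
      rw [← T_one]
      exact T_mem_spanT (one_mem _)
    | succ m ih =>
      intro hm
      rw [PB_succ]
      refine mul_mem_spanT_parB (ih (by omega)) (add_mem (T_mem_spanT (tB_mem_parB hm hl)) ?_)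
      rw [Algebra.algebraMap_eq_smul_one, ← T_one]
      exact Submodule.smul_mem _ _ (T_mem_spanT (one_mem _))
  exact key l le_rfl

theorem TinvB_mem_spanT {n l : ℕ} {u : WB n} (hu : u ∈ symB n l) :
    TinvB n u ∈ spanT (LB n) (symB n l : Set (WB n)) := by
  rw [TinvB, ← inv_inv u, ← bar_T]
  exact bar_mem_spanT (symB_generators n l) (T_mem_spanT (inv_mem hu))

theorem PB_mul_TinvB_mem_spanT {n l : ℕ} (hl : l ≤ n) :
    PB n l * TinvB n (sigmaB n l) ∈ spanT (LB n) (parB n l : Set (WB n)) :=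
  mul_mem_spanT_parB (PB_mem_spanT hl)
    (spanT_mono (symB_le_parB n l) (TinvB_mem_spanT (sigmaB_spec n l).1))

theorem mul_descProd_inv_mem_coeffsIn {n l : ℕ} (hl : l < n) {k : ℤ} {h : HB n}
    (hh : h ∈ coeffsIn (LB n) (vDegLE k)) :
    h * (descProd (fun i => (genUnit n i)⁻¹) l : (HB n)ˣ) ∈ coeffsIn (LB n) (vDegLE k) := by
  induction l generalizing h with
  | zero => simpa [descProd] using hh
  | succ l ih =>
    have e : (((genUnit n (l + 1))⁻¹ : (HB n)ˣ) : HB n) = Tsinv (LB n) ⟨l + 1, hl⟩ := by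
      rw [genUnit, sB, dif_pos hl, TUnit_simple_inv]
    rw [descProd, Units.val_mul, e, ← mul_assoc]
    exact ih (by omega) (mul_Tsinv_mem_coeffsIn (xi_LB_mul_mem (by simp)) hh)

theorem T_mem_coeffsIn (n : ℕ) (w : WB n) : T (LB n) w ∈ coeffsIn (LB n) (vDegLE 0) := by
  rw [← one_smul (GroupRing (ℤ ×ₗ ℤ)) (T (LB n) w)]
  exact smul_T_mem_coeffsIn (vpow_mem_vDegLE (γ := 0) le_rfl) w

/-- The bound is on the `V`-degree rather than membership in `A_{<0}`, because the weaker condition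
would not survive the multiplication by `C_σ` later on. -/
theorem PB_mul_TinvB_sub_mem {n l : ℕ} (hl : l ≤ n) :
    PB n l * TinvB n (sigmaB n l) - T (LB n) (aB n l) ∈ coeffsIn (LB n) (vDegLE (-1)) := by
  induction l with
  | zero =>
    have h : aB n 0 = 1 := rfl
    rw [TinvB_sigmaB_zero, mul_one, h, T_one]
    change (1 : HB n) - 1 ∈ _
    rw [sub_self]
    exact zero_mem _
  | succ l ih =>
    have ha : aB n l ∈ parB n l := aB_mem_parB (by omega)
    have hE := PB_mul_TinvB_mem_spanT (n := n) (l := l) (by omega)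
    have hd := ih (by omega)
    rw [PB_mul_TinvB_succ hl]
    generalize PB n l * TinvB n (sigmaB n l) = E at hE hd ⊢
    have hr : ∀ y ∈ parB n l, T (LB n) y * T (LB n) (rB n (l + 1)) =
        T (LB n) (y * rB n (l + 1)) := fun y hy =>
      T_mul _ _ _ (by rw [length_mul_rB hl hy, length_rB hl])
    have e : E * (T (LB n) (rB n (l + 1)) + algebraMap (GroupRing (ℤ ×ₗ ℤ)) (HB n) (Vpow (-1)) *
        (descProd (fun i => (genUnit n i)⁻¹) l : (HB n)ˣ)) - T (LB n) (aB n (l + 1)) =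
        (E - T (LB n) (aB n l)) * T (LB n) (rB n (l + 1)) +
          Vpow (-1) • (E * (descProd (fun i => (genUnit n i)⁻¹) l : (HB n)ˣ)) := by
      rw [aB_succ, ← hr _ ha, ← Algebra.smul_def, mul_add, mul_smul_comm, sub_mul]
      abel
    rw [e]
    -- In the first term right multiplication by `T_{r_{l+1}}` only relabels basis elements, the
    -- support lying in the type `B_l` parabolic subgroup. In the second the explicit `V⁻¹` lowers
    -- degree 0 to -1.
    refine add_mem (mul_mem_of_forall_T_mul fun w hw => ?_) ?_
    · rw [hr w (mem_spanT.mp (sub_mem hE (T_mem_spanT ha)) w hw)]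
      exact smul_T_mem_coeffsIn (hd w) _
    · have hE0 : E ∈ coeffsIn (LB n) (vDegLE 0) := by
        rw [← sub_add_cancel E (T (LB n) (aB n l))]
        exact add_mem (coeffsIn_mono (vDegLE_mono (by omega)) hd) (T_mem_coeffsIn n _)
      exact smul_mem_coeffsIn (fun b hb => mul_mem_vDegLE (k := -1) (m := 0)
        (vpow_mem_vDegLE le_rfl) hb (by omega))
        (mul_descProd_inv_mem_coeffsIn hl hE0)

theorem CB_aB {n l : ℕ} (hl : l ≤ n) : CB n (aB n l) = PB n l * TinvB n (sigmaB n l) :=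
  (eq_KLelt (isKL_iff.mpr ⟨bar_PB_mul_TinvB hl,
    coeffsIn_mono vDegLE_neg_one_le (PB_mul_TinvB_sub_mem hl)⟩)).symm

theorem CB_mem_spanT {n : ℕ} {u : WB n} (hu : u ∈ symB n n) :
    CB n u ∈ spanT (LB n) (symB n n : Set (WB n)) :=
  KLelt_mem_spanT (symB_generators n n) hu

/-- The error splits as `(C_{a_l} - T_{a_l}) C_σ + T_{a_l} (C_σ - T_σ)`. The first part keeps
`V`-degree at most -1, since multiplication by `C_σ` does not raise it; in the second, `T_{a_l}`
sends `T_w` to `T_{a_l w}` for `w ∈ 𝔖_n`, so the negative coefficients are unchanged. -/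
theorem CB_aB_mul_CB {n l : ℕ} (hl : l ≤ n) {u : WB n} (hu : u ∈ symB n n) :
    CB n (aB n l) * CB n u = CB n (aB n l * u) := by
  obtain ⟨hb1, -⟩ := isKL_iff.mp (KLelt_spec (LB n) (aB n l))
  obtain ⟨hb2, hn2⟩ := isKL_iff.mp (KLelt_spec (LB n) u)
  change bar (LB n) (CB n (aB n l)) = CB n (aB n l) at hb1
  change bar (LB n) (CB n u) = CB n u at hb2
  change CB n u - T (LB n) u ∈ _ at hn2
  have hn1 : CB n (aB n l) - T (LB n) (aB n l) ∈ coeffsIn (LB n) (vDegLE (-1)) := by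
    rw [CB_aB hl]
    exact PB_mul_TinvB_sub_mem hl
  have hT : ∀ w ∈ symB n n, T (LB n) (aB n l) * T (LB n) w = T (LB n) (aB n l * w) :=
    fun w hw => T_mul _ _ _ (length_aB_mul hl hw)
  have hu0 : CB n u ∈ coeffsIn (LB n) (vDegLE 0) := by
    rw [← sub_add_cancel (CB n u) (T (LB n) u)]
    exact add_mem (coeffsIn_mono negativePart_le_vDegLE hn2) (T_mem_coeffsIn n u)
  refine eq_KLelt (isKL_iff.mpr ⟨by rw [bar_mul, hb1, hb2], ?_⟩)
  have e : CB n (aB n l) * CB n u - T (LB n) (aB n l * u) =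
      (CB n (aB n l) - T (LB n) (aB n l)) * CB n u +
        T (LB n) (aB n l) * (CB n u - T (LB n) u) := by
    rw [← hT u hu, sub_mul, mul_sub]
    abel
  rw [e]
  refine add_mem (coeffsIn_mono vDegLE_neg_one_le (mul_mem_of_forall_mul_T fun w hw => ?_))
    (mul_mem_of_forall_mul_T fun w hw => ?_)
  · refine smul_mem_coeffsIn (fun b hb => mul_mem_vDegLE (hu0 w) hb (by omega))
      (mul_T_mem_coeffsIn (symB_generators n n) ?_ hn1 (mem_spanT.mp (CB_mem_spanT hu) w hw))
    rintro i ⟨k, h1, -, h3⟩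
    rw [simple_injective_B n h3]
    exact xi_LB_mul_mem h1
  · rw [hT w (mem_spanT.mp (sub_mem (CB_mem_spanT hu) (T_mem_spanT hu)) w hw)]
    exact smul_T_mem_coeffsIn (hn2 w) _

end Triangularity

/-! ### The symmetrizing form on `P_l h` -/

section Trace

/-- This isolates the part of `t_{l+1}` outside `𝔖_n`: the factor `(s_l ⋯ s_1)⁻¹` lies in `𝔖_n` and
can be absorbed into the element `h` of the trace formula. -/
theorem T_tB_eq {n l : ℕ} (hl : l < n) : T (LB n) (tB n (l + 1)) =
    T (LB n) (rB n (l + 1)) * T (LB n) (cosetB n l l)⁻¹ := by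
  have h := T_tB_mul hl
  rw [← bar_descProd hl, ← T_cosetB hl, bar_T, Units.mul_inv_eq_iff_eq_mul] at h
  exact h

theorem PB_mul_T_rB_mem_spanT {n l : ℕ} (hl : l < n) :
    PB n l * T (LB n) (rB n (l + 1)) ∈ spanT (LB n) ((symB n n : Set (WB n))ᶜ) := by
  have h := PB_mem_spanT (n := n) (l := l) hl.le
  generalize PB n l = x at h ⊢
  induction h using Submodule.span_induction with
  | mem x hx =>
    obtain ⟨w, hw, rfl⟩ := hx
    rw [T_mul _ _ _ (by rw [length_mul_rB hl hw, length_rB hl])]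
    exact T_mem_spanT (mul_rB_notMem_symB hl hw)
  | zero => simp
  | add x y _ _ hx hy => rw [add_mul]; exact add_mem hx hy
  | smul a x _ hx => rw [smul_mul_assoc]; exact Submodule.smul_mem _ _ hx

/-- Expanding the last factor of `P_{l+1}`, the term with `T_{t_{l+1}}` is supported on the
complement of `𝔖_n`, which is stable under right multiplication by `𝔖_n` and does not contain 1;
only the scalar `V⁻¹` contributes. -/
theorem tau_PB_mul {n l : ℕ} (hl : l ≤ n) {h : HB n}
    (hh : h ∈ spanT (LB n) (symB n n : Set (WB n))) :
    tau (LB n) (PB n l * h) = Vpow (-(l : ℤ)) * tau (LB n) h := by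
  induction l with
  | zero =>
    change tau (LB n) (1 * h) = _
    rw [one_mul, Nat.cast_zero, neg_zero, Vpow_zero, one_mul]
  | succ l ih =>
    have h0 : tau (LB n) (PB n l * T (LB n) (tB n (l + 1)) * h) = 0 := by
      have hc : (cosetB n l l)⁻¹ ∈ symB n n :=
        inv_mem (symB_mono n hl (cosetB_mem_symB hl le_rfl))
      have hX : ∀ w ∈ ((symB n n : Set (WB n))ᶜ), ∀ u ∈ symB n n, w * u ∈
          ((symB n n : Set (WB n))ᶜ) := fun w hw u hu hwu =>
        hw ((Subgroup.mul_mem_cancel_right _ hu).mp hwu)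
      rw [T_tB_eq hl, ← mul_assoc]
      have := mul_mem_spanT_symB hX
        (mul_mem_spanT_symB hX (PB_mul_T_rB_mem_spanT hl) (T_mem_spanT hc)) hh
      by_contra hne
      exact mem_spanT.mp this 1 hne (one_mem _)
    rw [PB_succ, mul_add, add_mul, map_add, h0, zero_add, ← Algebra.commutes, mul_assoc,
      ← Algebra.smul_def, map_smul, ih (by omega), smul_eq_mul, ← mul_assoc, Vpow_mul]
    congr 2
    push_cast
    ring

end Trace

end CoxeterKL

open CoxeterKL in
theorem proposition2p4 (n : ℕ) (hn : 1 ≤ n) (l : ℕ) (hl : l ≤ n) :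
    CB n (aB n l) = PB n l * TinvB n (sigmaB n l) ∧
    CB n (aB n l) = TinvB n (sigmaB n l) * PB n l ∧
    ∀ σ ∈ symB n n,
      CB n (aB n l) * CB n σ = CB n (aB n l * σ) ∧
      tau (LB n) (CB n (aB n l * σ)) =
        Vpow (-(l : ℤ)) * tau (LB n) (TinvB n (sigmaB n l) * CB n σ) := by
  refine ⟨CB_aB hl, (CB_aB hl).trans (commute_PB_TinvB hl).eq, fun σ hσ =>
    ⟨CB_aB_mul_CB hl hσ, ?_⟩⟩
  -- The order `P_l T_{σ_l}⁻¹` is the useful one: `T_{σ_l}⁻¹ C_σ` is supported on `𝔖_n`, as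
  -- `tau_PB_mul` requires.
  rw [← CB_aB_mul_CB hl hσ, CB_aB hl, mul_assoc]
  exact tau_PB_mul hl (mul_mem_spanT_symB (fun w hw u hu => mul_mem hw hu)
    (TinvB_mem_spanT (symB_mono n hl (sigmaB_spec n l).1)) (CB_mem_spanT hσ))
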